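/- Let $R$ be a commutative ring, $S=\mathrm{Spec}\,R$, let $G$ be a finite abelian group and let $H=G^D_S=\mathrm{Spec}\,R[G]$ be the Cartier dual of the constant group scheme $G_S$, a commutative $S$-group scheme whose group $H(T)$ of $T$-valued points, for an $R$-algebra $T$, is the group of characters $G\to T^\times$ (written additively below). For $I\subset\{1,\dots,n\}$ let $m_I:H^n\to H$ be $(h_1,\dots,h_n)\mapsto\sum_{i\in I}h_i$. For an invertible sheaf $\mathcal L$ on $H$ put $$\Theta_n(\mathcal L)=\bigotimes_{I\subset\{1,\dots,n\}}m_I^*(\mathcal L)^{\otimes(-1)^{n-\#I}} ,$$ an invertible sheaf on $H^n$. For $n\ge 2$, an $n$-cubic structure on $\mathcal L$ is an isomorphism $\xi:\mathcal O_{H^n}\xrightarrow{\sim}\Theta_n(\mathcal L)$ such that, under the canonical isomorphisms obtained by contracting duals and permuting factors, * (c0) $(0,\dots,0)^*\xi(1)=1$ in $(0,\dots,0)^*\Theta_n(\mathcal L)\simeq\mathcal O_S$; * (c1) $\sigma^*\xi(1)=\xi(1)$ in $\sigma^*\Theta_n(\mathcal L)\simeq\Theta_n(\mathcal L)$ for every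 permutation $\sigma$ of the factors of $H^n$; * (c2) $A^*\xi(1)\otimes B^*\xi(1)=C^*\xi(1)\otimes D^*\xi(1)$ in $A^*\Theta_n(\mathcal L)\otimes B^*\Theta_n(\mathcal L)\simeq C^*\Theta_n(\mathcal L)\otimes D^*\Theta_n(\mathcal L)$, where $A,B,C,D:H^{n+1}\to H^n$ send $(h_0,\dots,h_n)$ to $(h_0+h_1,h_2,\dots,h_n)$, $(h_0,h_1,h_3,\dots,h_n)$, $(h_0,h_1+h_2,h_3,\dots,h_n)$ and $(h_1,\dots,h_n)$. Let $n\ge1$, let $(\mathcal L,\xi)$ be an invertible sheaf on $H$ with an $(n+1)$-cubic structure, let $\Delta_n:H\to H^n$ be the diagonal, and put $$\delta(\mathcal L,\xi)=\Delta_n^*\Theta_n(\mathcal L),\qquad \mathcal L^\flat=\delta(\mathcal L,\xi)\otimes\mathcal L^{\otimes -n!}.$$ Write $E=\Theta_n(\mathcal L)$. The contraction isomorphism $\Theta_{n+1}(\mathcal L)\simeq C_i^*E\otimes A_i^*E^{-1}\otimes B_i^*E^{-1}$ (where $A_i$, $B_i:H^{n+1}\to H^n$ omit $h_i$, resp. $h_{i+1}$,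 and $C_i$ replaces $h_i,h_{i+1}$ by $h_i+h_{i+1}$) and $\xi$ give, for $1\le i\le n$, composition laws $$E_{(\dots,x,\dots)}\otimes E_{(\dots,y,\dots)}\xrightarrow{\sim}E_{(\dots,x+y,\dots)}$$ ($x$, $y$, $x+y$ in the $i$-th place). For points $\chi_1,\dots,\chi_n$ of $H$ and $S\subset\{1,\dots,n\}$ put $\chi_S=\sum_{i\in S}\chi_i$. Iterating the composition laws gives isomorphisms $$\bigotimes_{p:\{1,\dots,n\}\to S}E_{(\chi_{p(1)},\dots,\chi_{p(n)})}\xrightarrow{\sim}E_{(\chi_S,\dots,\chi_S)} .$$ Inserting them in $\Theta_n(\delta(\mathcal L,\xi))_{(\chi_1,\dots,\chi_n)}=\bigotimes_{S}E_{(\chi_S,\dots,\chi_S)}^{\otimes(-1)^{n-\#S}}$, contracting the terms with $p$ not a bijection of $\{1,\dots,n\}$, and identifying the terms for bijective $p$ by permutation of factors, one gets an isomorphism $E^{\otimes n!}\simeq\Theta_n(\delta(\mathcal L,\xi))$, and hence an isomorphism $$\xi^\flat:\mathcal O_{H^n}\xrightarrow{\sim}\Theta_n(\delta(\mathcal L,\xi))\otimes\Theta_n(\mathcal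 L)^{\otimes -n!}\simeq\Theta_n(\mathcal L^\flat).$$ 1. If $n\ge2$, then $\mathcal L^\flat$ is an invertible sheaf, there is exactly one isomorphism $\xi^\flat$ as described, and it is an $n$-cubic structure on $\mathcal L^\flat$. 2. (Taylor expansion) Let $n\ge1$, put $(\mathcal L^{(0)},\xi^{(0)})=(\mathcal L,\xi)$ and $(\mathcal L^{(i)},\xi^{(i)})=((\mathcal L^{(i-1)})^\flat,(\xi^{(i-1)})^\flat)$ for $1\le i\le n-1$, so that $\xi^{(i)}$ is an $(n+1-i)$-cubic structure on the invertible sheaf $\mathcal L^{(i)}$. There is an isomorphism of invertible sheaves on $H$ $$\mathcal L^{\otimes n!!}\simeq(0^*\mathcal L)^{\otimes n!!}\otimes\bigotimes_{i=0}^{n-1}\delta(\mathcal L^{(i)},\xi^{(i)})^{\otimes(-1)^i(n-i-1)!!},$$ where $m!!=m!\,(m-1)!\cdots2!$ (so $0!!=1!!=1$), where $0:H\to S\to H$ is the zero morphism, and where $\delta(\mathcal L^{(i)},\xi^{(i)})=\Delta_{n-i}^*\Theta_{n-i}(\mathcal L^{(i)})$. -/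

import Mathlib

open scoped TensorProduct

universe u

noncomputable section

namespace Hypercubic

/-! ### Invertible sheaves on affine schemes: pull-backs, integral tensor powers, local frames

A quasi-coherent sheaf on `Spec A` is given by its `A`-module of global sections; it is invertible
when this module satisfies `Module.Invertible`. -/

/-- The pull-back `f^* M = B ⊗_A M` of the sheaf `M` along `Spec B → Spec A`. -/
def pullback {A B : Type u} [CommRing A] [CommRing B] (f : A →+* B) (M : ModuleCat.{u} A) :
    ModuleCat.{u} B :=
  letI := f.toAlgebra
  ModuleCat.of B (B ⊗[A] M)

/-- The section `f^* m = 1 ⊗ m` of `f^* M`. -/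
def pullbackSection {A B : Type u} [CommRing A] [CommRing B] (f : A →+* B) (M : ModuleCat.{u} A) :
    M →ₛₗ[f] pullback f M :=
  letI := f.toAlgebra
  { toFun := fun m => ((1 : B) ⊗ₜ[A] m : B ⊗[A] M)
    map_add' := fun m m' => TensorProduct.tmul_add (1 : B) m m'
    map_smul' := fun a m => by
      change (1 : B) ⊗ₜ[A] (a • m) = f a • ((1 : B) ⊗ₜ[A] m)
      rw [TensorProduct.tmul_smul, ← algebraMap_smul B a ((1 : B) ⊗ₜ[A] m)]
      rfl }

/-- The canonical isomorphism `f^* (m^* L) ≃ (m ∘ f)^* L`, sending `t ⊗ (b ⊗ l)` to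
`f(b) t ⊗ l`. -/
def pullbackComp {A B T : Type u} [CommRing A] [CommRing B] [CommRing T]
    (m : A →+* B) (f : B →+* T) (L : ModuleCat.{u} A) :
    pullback f (pullback m L) ≃ₗ[T] pullback (f.comp m) L :=
  letI := m.toAlgebra
  letI := f.toAlgebra
  letI := (f.comp m).toAlgebra
  haveI : IsScalarTower A B T := IsScalarTower.of_algebraMap_eq (fun _ => rfl)
  TensorProduct.AlgebraTensorModule.cancelBaseChange A B T T L

/-- The integral tensor power `M^{⊗ k}`; for negative `k` it is a tensor power of the dual. -/
def tpow {A : Type u} [CommRing A] (M : ModuleCat.{u} A) : ℤ → ModuleCat.{u} A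
  | Int.ofNat k => ModuleCat.of A (⨂[A] _ : Fin k, M)
  | Int.negSucc k => ModuleCat.of A (⨂[A] _ : Fin (k + 1), Module.Dual A M)

/-- The coordinate of (the pull-back under `f` of) a section of `M`, with respect to a
trivialization `e` of `f^* M`. -/
def coordPos {A T : Type u} [CommRing A] [CommRing T] (f : A →+* T) {M : ModuleCat.{u} A}
    (e : pullback f M ≃ₗ[T] T) : M →ₛₗ[f] T :=
  e.toLinearMap.comp (pullbackSection f M)

/-- The pull-back under `f` of a linear form `φ` on `M`: the form `t ⊗ m ↦ t · f(φ(m))`. -/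
def pullbackForm {A T : Type u} [CommRing A] [CommRing T] (f : A →+* T) {M : ModuleCat.{u} A}
    (φ : Module.Dual A M) : pullback f M →ₗ[T] T :=
  letI := f.toAlgebra
  LinearMap.liftBaseChange T ((Algebra.linearMap A T).comp φ)

/-- The coordinate of (the pull-back under `f` of) a section `φ` of the dual of `M`, with respect
to the trivialization of the dual of `f^* M` induced by the trivialization `e` of `f^* M`:
the value of `φ` at the generator `e⁻¹(1)`. -/
def coordNeg {A T : Type u} [CommRing A] [CommRing T] (f : A →+* T) {M : ModuleCat.{u} A}
    (e : pullback f M ≃ₗ[T] T) : Module.Dual A M →ₛₗ[f] T :=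
  letI := f.toAlgebra
  { toFun := fun φ => pullbackForm f φ (e.symm 1)
    map_add' := fun φ ψ => by
      change LinearMap.liftBaseChange T ((Algebra.linearMap A T).comp (φ + ψ)) (e.symm 1) =
        LinearMap.liftBaseChange T ((Algebra.linearMap A T).comp φ) (e.symm 1) +
        LinearMap.liftBaseChange T ((Algebra.linearMap A T).comp ψ) (e.symm 1)
      generalize (e.symm 1) = z
      induction z using TensorProduct.induction_on with
      | zero => simp
      | tmul t m => simp [mul_add]
      | add a b ha hb =>
        rw [map_add, map_add, map_add, ha, hb]
        abel
    map_smul' := fun a φ => by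
      change LinearMap.liftBaseChange T ((Algebra.linearMap A T).comp (a • φ)) (e.symm 1) =
        f a * LinearMap.liftBaseChange T ((Algebra.linearMap A T).comp φ) (e.symm 1)
      have hf : algebraMap A T = f := rfl
      generalize (e.symm 1) = z
      induction z using TensorProduct.induction_on with
      | zero => simp
      | tmul t m => simp [hf, mul_left_comm]
      | add a b ha hb => rw [map_add, map_add, ha, hb, mul_add] }

/-- For semilinear coordinate functions `φ i` on the modules `M i`, the coordinate function
`⨂ m_i ↦ ∏ φ_i (m_i)` on their tensor product. -/
def coordTensor {A T : Type u} [CommRing A] [CommRing T] (f : A →+* T) {ι : Type} [Fintype ι]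
    {M : ι → Type u} [∀ i, AddCommGroup (M i)] [∀ i, Module A (M i)]
    (φ : ∀ i, M i →ₛₗ[f] T) : (⨂[A] i, M i) →ₛₗ[f] T :=
  letI := f.toAlgebra
  let φ' : ∀ i, M i →ₗ[A] T := fun i =>
    { toFun := φ i
      map_add' := (φ i).map_add
      map_smul' := fun a m => by
        rw [LinearMap.map_smulₛₗ, RingHom.id_apply, Algebra.smul_def]; rfl }
  let F : (⨂[A] i, M i) →ₗ[A] T :=
    PiTensorProduct.lift ((MultilinearMap.mkPiAlgebra A ι T).compLinearMap φ')
  { toFun := F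
    map_add' := F.map_add
    map_smul' := fun a m => by
      rw [F.map_smul, Algebra.smul_def]; rfl }

theorem coordTensor_tprod {A T : Type u} [CommRing A] [CommRing T] (f : A →+* T) {ι : Type}
    [Fintype ι] {M : ι → Type u} [∀ i, AddCommGroup (M i)] [∀ i, Module A (M i)]
    (φ : ∀ i, M i →ₛₗ[f] T) (m : ∀ i, M i) :
    coordTensor f φ (PiTensorProduct.tprod A m) = ∏ i, φ i (m i) := by
  let := f.toAlgebra
  simp [coordTensor]

/-- The coordinate function on `M^{⊗ k}` induced by a trivialization `e` of `f^* M`. -/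
def coordPow {A T : Type u} [CommRing A] [CommRing T] (f : A →+* T) {M : ModuleCat.{u} A}
    (e : pullback f M ≃ₗ[T] T) : (k : ℤ) → (tpow M k →ₛₗ[f] T)
  | Int.ofNat _ => coordTensor f (fun _ => coordPos f e)
  | Int.negSucc _ => coordTensor f (fun _ => coordNeg f e)

/-! ### The Cartier dual `H` of a finite constant commutative group scheme, and `Θ_n` -/

variable (R : Type u) [CommRing R] (G : Type u) [CommGroup G]

/-- The coordinate ring of `H^n` over `S = Spec R`, where `H = Spec R[G]` is the Cartier dual of
the constant group scheme `G`.  The group `H(T)` of `T`-valued points of `H` is the group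
`G →* T` of `T`-valued characters of `G`. -/
abbrev CoordRing (n : ℕ) : Type u := MonoidAlgebra R (Fin n → G)

variable {G}

/-- The algebra homomorphism `R[G] → T` of the `T`-valued point of `H` given by a character. -/
def pt {T : Type u} [CommRing T] [Algebra R T] (χ : G →* T) : MonoidAlgebra R G →ₐ[R] T :=
  MonoidAlgebra.lift R T G χ

/-- The algebra homomorphism `R[G^n] → T` of the `T`-valued point `(χ_1, …, χ_n)` of `H^n`;
it sends `(g_1, …, g_n)` to `∏ χ_i(g_i)`. -/
def ptPow {T : Type u} [CommRing T] [Algebra R T] {n : ℕ} (χ : Fin n → (G →* T)) :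
    CoordRing R G n →ₐ[R] T :=
  MonoidAlgebra.lift R T (Fin n → G) (∏ i, (χ i).comp (Pi.evalMonoidHom (fun _ => G) i))

variable (G)

/-- The universal point of `H^n`: the `i`-th projection `H^n → H`, as a character of `G` with
values in `R[G^n]`. -/
def univChar (n : ℕ) (i : Fin n) : G →* CoordRing R G n :=
  (MonoidAlgebra.of R (Fin n → G)).comp (MonoidHom.mulSingle (fun _ => G) i)

/-- The morphism `m_I : H^n → H`, `(h_1, …, h_n) ↦ ∑_{i ∈ I} h_i`. -/
def mHom (n : ℕ) (I : Finset (Fin n)) : MonoidAlgebra R G →ₐ[R] CoordRing R G n :=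
  pt R (∏ i ∈ I, univChar R G n i)

/-- The diagonal `Δ_n : H → H^n`. -/
def diagHom (n : ℕ) : CoordRing R G n →ₐ[R] MonoidAlgebra R G :=
  ptPow R (fun _ => MonoidAlgebra.of R G)

/-- The zero morphism `0 : H → S → H`. -/
def zeroHom : MonoidAlgebra R G →ₐ[R] MonoidAlgebra R G :=
  pt R (1 : G →* MonoidAlgebra R G)

variable {R G}

/-- `Θ_n(L) = ⨂_{I ⊂ {1, …, n}} (m_I^* L)^{(-1)^{n - #I}}`, a sheaf on `H^n`. -/
def Theta (n : ℕ) (L : ModuleCat.{u} (MonoidAlgebra R G)) : ModuleCat.{u} (CoordRing R G n) :=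
  ModuleCat.of _ (⨂[CoordRing R G n] I : Finset (Fin n),
    tpow (pullback (mHom R G n I).toRingHom L) ((-1) ^ (n - I.card)))

/-- A trivialization `O_{H^n} ≃ Θ_n(L)`. -/
abbrev Triv (n : ℕ) (L : ModuleCat.{u} (MonoidAlgebra R G)) : Type u :=
  CoordRing R G n ≃ₗ[CoordRing R G n] Theta n L

/-- Trivializations of the pull-backs `x^* L`, one for each `T`-valued point `x` of `H`.
(They exist whenever `L` is invertible and `T` is local.) -/
abbrev Frame (L : ModuleCat.{u} (MonoidAlgebra R G)) (T : Type u) [CommRing T] [Algebra R T] :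
    Type u :=
  ∀ x : MonoidAlgebra R G →ₐ[R] T, pullback x.toRingHom L ≃ₗ[T] T

/-- The coordinate at the `T`-valued point `x` of `H^n` of a section of `Θ_n(L)` with respect to
the generator `⨂_I t_I^{(-1)^{n - #I}}` of `x^* Θ_n(L)`, where `t_I` is the generator of
`x^* m_I^* L = (m_I ∘ x)^* L` given by the frame `e`. -/
def thetaCoord {n : ℕ} {L : ModuleCat.{u} (MonoidAlgebra R G)} {T : Type u} [CommRing T]
    [Algebra R T] (e : Frame L T) (x : CoordRing R G n →ₐ[R] T) :
    Theta n L →ₛₗ[x.toRingHom] T :=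
  coordTensor x.toRingHom (fun I : Finset (Fin n) =>
    coordPow x.toRingHom
      ((pullbackComp (mHom R G n I).toRingHom x.toRingHom L).trans (e (x.comp (mHom R G n I)))) _)

/-- The coordinate of the generator `ξ(1)` of `Θ_n(L)` at the `T`-valued point `(χ_1, …, χ_n)`. -/
def trivCoord {n : ℕ} {L : ModuleCat.{u} (MonoidAlgebra R G)} (ξ : Triv n L) {T : Type u}
    [CommRing T] [Algebra R T] (e : Frame L T) (χ : Fin n → (G →* T)) : T :=
  thetaCoord e (ptPow R χ) (ξ 1)

/-! ### Hypercubic structures -/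

section Maps

variable {P : Type u} [CommMonoid P] {n : ℕ}

/-- `(h_0, …, h_n) ↦ (h_0 + h_1, h_2, …, h_n)`; the group law of `H` is written multiplicatively,
as a product of characters. -/
def mapA (h : Fin (n + 1) → P) : Fin n → P := fun i =>
  if i.val = 0 then h i.castSucc * h i.succ else h i.succ

/-- `(h_0, …, h_n) ↦ (h_0, h_1, h_3, …, h_n)`. -/
def mapB (h : Fin (n + 1) → P) : Fin n → P := fun i =>
  if i.val < 2 then h i.castSucc else h i.succ

/-- `(h_0, …, h_n) ↦ (h_0, h_1 + h_2, h_3, …, h_n)`. -/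
def mapC (h : Fin (n + 1) → P) : Fin n → P := fun i =>
  if i.val = 0 then h i.castSucc
  else if i.val = 1 then h i.castSucc * h i.succ
  else h i.succ

/-- `(h_0, …, h_n) ↦ (h_1, h_2, …, h_n)`. -/
def mapD (h : Fin (n + 1) → P) : Fin n → P := fun i => h i.succ

end Maps

/-- The trivialization `ξ` of `Θ_n(L)` is an `n`-cubic structure on `L` (for `n ≥ 2`).

The canonical isomorphisms `0^* Θ_n(L) ≃ O_S`, `σ^* Θ_n(L) ≃ Θ_n(L)` and
`A^* Θ_n(L) ⊗ B^* Θ_n(L) ≃ C^* Θ_n(L) ⊗ D^* Θ_n(L)`, obtained by contracting duals and permuting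
factors, are the isomorphisms which locally carry a monomial in generators of the pull-backs of `L`
to the same monomial.  Hence the three conditions are equalities between coordinates
with respect to arbitrary generators of the pull-backs of `L` to arbitrary `R`-algebras `T`. -/
structure IsCubic (n : ℕ) (L : ModuleCat.{u} (MonoidAlgebra R G)) (ξ : Triv n L) : Prop where
  rigid : ∀ (T : Type u) [CommRing T] [Algebra R T] (e : Frame L T),
    trivCoord ξ e (fun _ => 1) = 1
  symm : ∀ (T : Type u) [CommRing T] [Algebra R T] (e : Frame L T) (χ : Fin n → (G →* T))
    (σ : Equiv.Perm (Fin n)), trivCoord ξ e (fun i => χ (σ i)) = trivCoord ξ e χ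
  cocycle : ∀ (T : Type u) [CommRing T] [Algebra R T] (e : Frame L T)
    (χ : Fin (n + 1) → (G →* T)),
    trivCoord ξ e (mapA χ) * trivCoord ξ e (mapB χ) =
      trivCoord ξ e (mapC χ) * trivCoord ξ e (mapD χ)

/-! ### The sheaves `δ` and `L^♭`, and the structure `ξ^♭` -/

/-- `δ(L) = Δ_n^* Θ_n(L)`, a sheaf on `H`. -/
def delta (n : ℕ) (L : ModuleCat.{u} (MonoidAlgebra R G)) : ModuleCat.{u} (MonoidAlgebra R G) :=
  pullback (diagHom R G n).toRingHom (Theta n L)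

/-- `L^♭ = δ(L) ⊗ L^{⊗ -n!}`. -/
def flat (n : ℕ) (L : ModuleCat.{u} (MonoidAlgebra R G)) : ModuleCat.{u} (MonoidAlgebra R G) :=
  ModuleCat.of _ (delta n L ⊗[MonoidAlgebra R G] tpow L (-(n.factorial : ℤ)))

/-- The frame `e'` of `L^♭` is the one induced by the frame `e` of `L`: at a `T`-valued point `x`
of `H` its coordinate is the product of the coordinate on `x^* Δ_n^* Θ_n(L)` and the coordinate
on `x^* L^{⊗ -n!}` which are induced by `e`. -/
def IsInducedFrame {n : ℕ} {L : ModuleCat.{u} (MonoidAlgebra R G)} {T : Type u} [CommRing T]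
    [Algebra R T] (e : Frame L T) (e' : Frame (flat n L) T) : Prop :=
  ∀ (x : MonoidAlgebra R G →ₐ[R] T) (θ : Theta n L) (w : tpow L (-(n.factorial : ℤ))),
    coordPos x.toRingHom (e' x)
        (pullbackSection (diagHom R G n).toRingHom (Theta n L) θ ⊗ₜ[MonoidAlgebra R G] w :
          delta n L ⊗[MonoidAlgebra R G] tpow L (-(n.factorial : ℤ))) =
      thetaCoord e (x.comp (diagHom R G n)) θ * coordPow x.toRingHom (e x) _ w

/-- Let `E = Θ_n(L)`, for `L` with an `(n+1)`-cubic structure `ξ`.  The contraction isomorphism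
`Θ_{n+1}(L) ≃ C_i^* Θ_n(L) ⊗ A_i^* Θ_n(L)^{-1} ⊗ B_i^* Θ_n(L)^{-1}` and `ξ` give the `i`-th partial
composition law of the `n`-extension `E`,
`E_{(…, x, …)} ⊗ E_{(…, y, …)} ≃ E_{(…, x + y, …)}` (`x`, `y`, `x + y` in the `i`-th place).
With respect to the generators of the fibers of `E` induced by a frame of `L` it is multiplication
by `c(…, x, y, …)`, where `c` is the coordinate of `ξ(1)`.

`compCoord c i χ l` is the coordinate of the iterated composition
`⨂_{x ∈ l} E_{(…, x, …)} ≃ E_{(…, ∑ l, …)}` in the `i`-th place, the other places being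
those of `χ`: the product of `c(…, x_k, x_{k+1} + ⋯ + x_m, …)` over `1 ≤ k < m`, if
`l = [x_1, …, x_m]`. -/
def compCoord {P : Type u} [CommMonoid P] {T : Type u} [CommRing T] {n : ℕ}
    (c : (Fin (n + 1) → P) → T) (i : Fin n) (χ : Fin n → P) : List P → T
  | [] => 1
  | [_] => 1
  | x :: y :: l =>
    c (i.castSucc.insertNth (α := fun _ => P) x (Function.update χ i (y :: l).prod)) *
      compCoord c i χ (y :: l)

/-- The coordinate of the isomorphism
`⨂_{p : {1, …, n} → S} E_{(χ_{p(1)}, …, χ_{p(n)})} ≃ E_{(χ_S, …, χ_S)}`, `χ_S = ∑_{i ∈ S} χ_i`,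
which is the composition of partial composition laws in the `n`-th, …, second and first place:
the composition in the `j`-th place is applied to the sheaves
`E_{(χ_{p(1)}, …, χ_{p(j-1)}, χ_i, χ_S, …, χ_S)}`, `i ∈ S`, for all `p : {1, …, j-1} → S`. -/
def multCoord {P : Type u} [CommMonoid P] {T : Type u} [CommRing T] {n : ℕ}
    (c : (Fin (n + 1) → P) → T) (χ : Fin n → P) (S : Finset (Fin n)) : T :=
  ∏ j : Fin n, ∏ p : ({k : Fin n // k < j} → S),
    compCoord c j (fun k => if h : k < j then χ (p ⟨k, h⟩) else ∏ i ∈ S, χ i)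
      ((S.sort (· ≤ ·)).map χ)

/-- The trivialization `η` of `Θ_n(L^♭)` is the canonical one `ξ^♭` that is constructed from the
trivialization `ξ` of `Θ_{n+1}(L)`, namely
`O ≃ E^{⊗ n!} ⊗ Θ_n(L)^{⊗ -n!} ≃ Θ_n(δ(L)) ⊗ Θ_n(L)^{⊗ -n!} ≃ Θ_n(L^♭)`, where `E = Θ_n(L)` and where
`E^{⊗ n!} ≃ Θ_n(δ(L))` is the isomorphism obtained from
`Θ_n(δ(L))_χ = ⨂_S E_{(χ_S, …, χ_S)}^{(-1)^{n - #S}}` by expanding `E_{(χ_S, …, χ_S)}` with the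
composition laws of `E` into the tensor product of the `E_{(χ_{p(1)}, …, χ_{p(n)})}`, over
`p : {1, …, n} → S`, by contracting the terms of non-surjective `p : {1, …, n} → {1, …, n}`, and by
using the symmetry of `E` for bijective `p`.

In coordinates this says `η = ∏_S d_S^{(-1)^{n - #S}}`, with `d_S` the coordinate of the
isomorphism for `S`; the factors with negative exponent are moved to the other side. -/
def IsFlatStructure {n : ℕ} {L : ModuleCat.{u} (MonoidAlgebra R G)} (ξ : Triv (n + 1) L)
    (η : Triv n (flat n L)) : Prop :=
  ∀ (T : Type u) [CommRing T] [Algebra R T] (e : Frame L T) (e' : Frame (flat n L) T),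
    IsInducedFrame e e' → ∀ χ : Fin n → (G →* T),
      trivCoord η e' χ *
          ∏ S : Finset (Fin n) with Odd (n - S.card), multCoord (trivCoord ξ e) χ S =
        ∏ S : Finset (Fin n) with Even (n - S.card), multCoord (trivCoord ξ e) χ S

/-! ### Iteration -/

variable (R G)

/-- A sheaf `L` on `H` with a trivialization of `Θ_k(L)`, where `k` is the order. -/
structure HyperSheaf where
  order : ℕ
  sheaf : ModuleCat.{u} (MonoidAlgebra R G)
  triv : Triv order sheaf

variable {R G}

/-- `X` is an invertible sheaf with a hypercubic structure (of the order of `X`). -/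
def HyperSheaf.IsCubicSheaf (X : HyperSheaf R G) : Prop :=
  Module.Invertible (MonoidAlgebra R G) X.sheaf ∧ IsCubic X.order X.sheaf X.triv

/-- `δ(L, ξ) = Δ_n^* Θ_n(L)` for an invertible sheaf `L` with an `(n+1)`-cubic structure `ξ`. -/
def HyperSheaf.deltaSheaf (X : HyperSheaf R G) : ModuleCat.{u} (MonoidAlgebra R G) :=
  delta (X.order - 1) X.sheaf

/-- The relation `(L', ξ') = (L^♭, ξ^♭)` between `(L, ξ)` and `(L', ξ')`. -/
inductive IsFlatOf : HyperSheaf R G → HyperSheaf R G → Prop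
  | mk (n : ℕ) (L : ModuleCat.{u} (MonoidAlgebra R G)) (ξ : Triv (n + 1) L)
      (η : Triv n (flat n L)) (h : IsFlatStructure ξ η) :
      IsFlatOf ⟨n + 1, L, ξ⟩ ⟨n, flat n L, η⟩

end Hypercubic

end

/-!
Everything is reduced to computations with coordinates. Let `P` be a commutative monoid of
`T`-valued points of `H`, and choose a generator of `p^* L` for each `p ∈ P` (a `FrameAlong`). In
these coordinates a generator of `Θ_n(L)` is a function `P^n → Tˣ`; multiplying the coordinates of
`L` by `u : P → Tˣ` multiplies this function by the alternating product `θ_n(u)` of the values of `u`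
(`FrameRel.thetaCoordAlong_eq`), and multiplies the induced coordinates of `L^♭` by
`u^♭(p) = θ_n(u)(p, …, p) u(p)^{-n!}` (`FrameRel.flat`). On the level of functions, `ξ ↦ ξ^♭` is an
explicit homomorphism `flatLog`.

The key identity is `θ_{n+1}(b)^♭ = θ_n(b^♭)` (`flatLog_tupleCube`): if `ξ` is a coboundary, the
composition laws are ratios of values of `θ_n(b)`, so that their composition telescopes to
`θ_n(b)(χ_S, …, χ_S) / ∏_p θ_n(b)(χ_{p(1)}, …, χ_{p(n)})`, and in the alternating product over `S`
only the bijective `p` survive, by inclusion–exclusion (`sum_sum_tuple`). The claims about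
`ξ^♭` are proved as follows.

* `ξ^♭` is cubic. Over a local ring frames exist, and the claim is one about functions on a
  commutative monoid; pulling back to a free commutative monoid, every `(n + 1)`-cubic function is a
  coboundary (`exists_eq_cube`), so its transform is a coboundary as well, hence `n`-cubic
  (`IsCubicFun.flatLog`). The conditions can be tested over local rings (`isCubic_of_isLocalRing`).
* `ξ^♭` exists. The quotient of the coordinate of a section of `Θ_n(L^♭)` by the prescribed
  coordinate of `ξ^♭(1)` does not depend on the frame, by the key identity
  (`FrameRel.normCoord_eq`). Take it over a faithfully flat algebra on which the pull-backs of `L`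
  along the finitely many points `H^n → H` given by homomorphisms `G → G^n` become trivial; by
  independence it descends (`exists_trivialization_of_descent`, `exists_isFlatStructure`).
* `ξ^♭` is unique, since its coordinates are determined over the local rings of `H^n`
  (`IsFlatStructure.unique`).

The Taylor expansion is then a computation in the Picard group of `H`. As `∑_I (-1)^{n - #I} = 0`,
the sheaf `0^* δ(L)` is trivial for `n ≥ 1`, whence `0^* L^♭ = (0^* L)^{⊗ -n!}`; inserting this and
`L^♭ = δ(L) ⊗ L^{⊗ -n!}` into the expansion of `L^♭` gives the one of `L` (`exists_taylor`).
-/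

noncomputable section

namespace Hypercubic

/-! ### Finite differences and hypercubic functions on a commutative monoid -/

section Differences

variable {P Q ι : Type*} [CommMonoid P] [AddCommGroup Q]

/-- The difference `y ↦ b (x y) - b y` of a function on a commutative monoid. -/
def diff (x : P) (b : P → Q) : P → Q := fun y => b (x * y) - b y

theorem diff_comm (x y : P) (b : P → Q) : diff x (diff y b) = diff y (diff x b) := by
  funext z
  simp only [diff]
  rw [mul_left_comm]
  abel

instance : LeftCommutative (diff : P → (P → Q) → P → Q) := ⟨diff_comm⟩

/-- The iterated difference of `b` in the directions listed in `s`. -/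
def iterDiff (b : P → Q) (s : Multiset P) : P → Q := s.foldr diff b

theorem iterDiff_cons (b : P → Q) (x : P) (s : Multiset P) :
    iterDiff b (x ::ₘ s) = diff x (iterDiff b s) := Multiset.foldr_cons _ _ _ _

theorem iterDiff_diff (b : P → Q) (x : P) (s : Multiset P) :
    iterDiff (diff x b) s = diff x (iterDiff b s) := by
  induction s using Multiset.induction with
  | empty => rfl
  | cons y s ih => rw [iterDiff_cons, iterDiff_cons, ih, diff_comm]

/-- The alternating sum `∑_{t ≤ s} (-1)^{#s - #t} b (∏ t)`, encoded as an iterated difference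
evaluated at `1`. -/
def cube (b : P → Q) (s : Multiset P) : Q := iterDiff b s 1

theorem cube_zero (b : P → Q) : cube b 0 = b 1 := rfl

theorem cube_cons (b : P → Q) (x : P) (s : Multiset P) :
    cube b (x ::ₘ s) = cube (diff x b) s := by
  rw [cube, cube, iterDiff_cons, iterDiff_diff]

theorem cube_cons' (b : P → Q) (x : P) (s : Multiset P) :
    cube b (x ::ₘ s) = iterDiff b s x - iterDiff b s 1 := by
  rw [cube, iterDiff_cons, diff, mul_one]

theorem cube_cons_cons (b : P → Q) (x y : P) (s : Multiset P) :
    cube b (x ::ₘ y ::ₘ s) = cube b ((x * y) ::ₘ s) - cube b (x ::ₘ s) - cube b (y ::ₘ s) := by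
  rw [cube_cons' b x (y ::ₘ s)]
  simp only [cube_cons', iterDiff_cons, diff, mul_one, mul_comm y x]
  abel

theorem cube_one_cons (b : P → Q) (s : Multiset P) : cube b (1 ::ₘ s) = 0 := by
  rw [cube_cons', sub_self]

theorem iterDiff_add (b b' : P → Q) (s : Multiset P) :
    iterDiff (b + b') s = iterDiff b s + iterDiff b' s := by
  induction s using Multiset.induction with
  | empty => rfl
  | cons y s ih =>
    rw [iterDiff_cons, iterDiff_cons, iterDiff_cons, ih]
    funext z
    simp only [diff, Pi.add_apply]
    abel

theorem cube_add (b b' : P → Q) (s : Multiset P) : cube (b + b') s = cube b s + cube b' s := by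
  rw [cube, iterDiff_add, Pi.add_apply, cube, cube]

theorem cube_zero_fun (s : Multiset P) : cube (0 : P → Q) s = 0 := by
  have := cube_add (0 : P → Q) 0 s
  simpa using this

theorem cube_neg (b : P → Q) (s : Multiset P) : cube (-b) s = -cube b s := by
  have := cube_add (-b) b s
  rw [neg_add_cancel, cube_zero_fun] at this
  exact eq_neg_of_add_eq_zero_left this.symm

theorem cube_sub (b b' : P → Q) (s : Multiset P) : cube (b - b') s = cube b s - cube b' s := by
  rw [sub_eq_add_neg, cube_add, cube_neg, sub_eq_add_neg]

theorem cube_nsmul (k : ℕ) (b : P → Q) (s : Multiset P) : cube (k • b) s = k • cube b s := by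
  induction k with
  | zero => rw [zero_smul, zero_smul, cube_zero_fun]
  | succ k ih => rw [succ_nsmul, succ_nsmul, cube_add, ih]

theorem cube_eq_sum (b : P → Q) (χ : ι → P) (s : Finset ι) :
    cube b (s.val.map χ) =
      ∑ I ∈ s.powerset, ((-1 : ℤ) ^ (s.card - I.card)) • b (∏ i ∈ I, χ i) := by
  classical
  induction s using Finset.induction generalizing b with
  | empty => simp [cube_zero]
  | insert a s ha ih =>
    rw [Finset.insert_val_of_notMem ha, Multiset.map_cons, cube_cons, ih,
      Finset.sum_powerset_insert ha, ← Finset.sum_add_distrib]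
    refine Finset.sum_congr rfl fun I hI => ?_
    have hIs := Finset.mem_powerset.mp hI
    have haI : a ∉ I := fun h => ha (hIs h)
    have hc := Finset.card_le_card hIs
    rw [Finset.card_insert_of_notMem ha, Finset.card_insert_of_notMem haI,
      Nat.add_sub_add_right, Nat.succ_sub hc, pow_succ, Finset.prod_insert haI, diff, smul_sub]
    simp [sub_eq_neg_add]

/-- A function `C` on multisets (hence symmetric) is `m`-cubic: it vanishes on multisets of
cardinality `m` containing `1`, and is a `2`-cocycle in each pair of variables. -/
structure IsCubicMultiset (m : ℕ) (C : Multiset P → Q) : Prop where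
  one_cons : ∀ s : Multiset P, s.card + 1 = m → C (1 ::ₘ s) = 0
  cocycle : ∀ (x y z : P) (s : Multiset P), s.card + 2 = m →
    C ((x * y) ::ₘ z ::ₘ s) + C (x ::ₘ y ::ₘ s) = C (x ::ₘ (y * z) ::ₘ s) + C (y ::ₘ z ::ₘ s)

theorem cube_cocycle (b : P → Q) (x y z : P) (s : Multiset P) :
    cube b ((x * y) ::ₘ z ::ₘ s) + cube b (x ::ₘ y ::ₘ s) =
      cube b (x ::ₘ (y * z) ::ₘ s) + cube b (y ::ₘ z ::ₘ s) := by
  simp only [cube_cons_cons, mul_assoc]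
  abel

end Differences

/-! ### Hypercubic functions on a free commutative monoid are alternating sums -/

section Free

variable {ι Q : Type*} [AddCommGroup Q]

/-- The generator of the free commutative monoid on `ι` that is given by `i`. -/
def gen (i : ι) : Multiplicative (Multiset ι) := Multiplicative.ofAdd {i}

theorem free_induction {motive : Multiplicative (Multiset ι) → Prop} (one : motive 1)
    (mul : ∀ i p, motive p → motive (gen i * p)) (p) : motive p :=
  Multiset.induction (p := fun s => motive (Multiplicative.ofAdd s)) one
    (fun i _ h => mul i _ h) p.toAdd

/-- A compatible system of differences in the directions of the generators has a potential. -/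
theorem exists_potential (d : ι → Multiplicative (Multiset ι) → Q)
    (h : ∀ i j, diff (gen j) (d i) = diff (gen i) (d j)) :
    ∃ b : Multiplicative (Multiset ι) → Q, b 1 = 0 ∧ ∀ i, diff (gen i) b = d i := by
  let b : Multiset ι → Q := fun s => Multiset.recOn (C := fun _ => Q) s 0
    (fun i t acc => acc + d i (Multiplicative.ofAdd t)) (fun i j t acc => heq_of_eq (by
      have := congrFun (h i j) (Multiplicative.ofAdd t)
      simp only [diff, gen, ← ofAdd_add, Multiset.singleton_add] at this
      rw [sub_eq_sub_iff_add_eq_add] at this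
      rw [add_assoc, add_assoc, add_comm (d j _), this, add_comm (d j _)]))
  refine ⟨fun p => b p.toAdd, rfl, fun i => ?_⟩
  funext p
  have : b (i ::ₘ p.toAdd) = b p.toAdd + d i p :=
    Multiset.recOn_cons (C := fun _ => Q) i p.toAdd
  simp only [diff, gen, toAdd_mul, toAdd_ofAdd, Multiset.singleton_add, this]
  abel

/-- All differences of order `< m` of `b` in the directions of the generators vanish at `1`. -/
def IsNormalized (m : ℕ) (b : Multiplicative (Multiset ι) → Q) : Prop :=
  ∀ t : Multiset ι, t.card < m → cube b (t.map gen) = 0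

theorem IsNormalized.diff {m : ℕ} {b : Multiplicative (Multiset ι) → Q}
    (h : IsNormalized (m + 1) b) (i : ι) : IsNormalized m (diff (gen i) b) := fun t ht => by
  rw [← cube_cons, ← Multiset.map_cons]
  exact h _ (by simpa using ht)

theorem IsNormalized.eq_zero {m : ℕ} (hm : 1 ≤ m) {b : Multiplicative (Multiset ι) → Q}
    (h : IsNormalized m b) (h0 : ∀ s, s.card = m → cube b s = 0) : b = 0 := by
  induction m, hm using Nat.le_induction generalizing b with
  | base =>
    funext x
    have h1 := h 0 (by simp)
    have h2 := h0 {x} (by simp)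
    rw [Multiset.map_zero, cube_zero] at h1
    rw [← Multiset.cons_zero, cube_cons'] at h2
    simpa [iterDiff, h1] using h2
  | succ m hm ih =>
    have hd : ∀ i, Hypercubic.diff (gen i) b = 0 := fun i => ih (h.diff i) fun s hs => by
      rw [← cube_cons]
      exact h0 _ (by simp [hs])
    funext p
    induction p using free_induction with
    | one => simpa [cube_zero] using h 0 (by simp)
    | mul i p ihp =>
      have := congrFun (hd i) p
      simp only [Hypercubic.diff, Pi.zero_apply, sub_eq_zero] at this
      rw [this, ihp]
      rfl

/-- On a free commutative monoid every `m`-cubic function is an alternating sum.  The function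
`C (gen i, …)` is `(m - 1)`-cubic, hence of the form `cube (d i)` with a unique normalized `d i`;
uniqueness makes the `d i` compatible, and their potential is the required function. -/
theorem exists_eq_cube {m : ℕ} (hm : 1 ≤ m) {C : Multiset (Multiplicative (Multiset ι)) → Q}
    (hC : IsCubicMultiset m C) :
    ∃ b, IsNormalized m b ∧ ∀ s, s.card = m → C s = cube b s := by
  induction m, hm using Nat.le_induction generalizing C with
  | base =>
    have h1 : C {1} = 0 := hC.one_cons 0 (by simp)
    refine ⟨fun x => C {x}, fun t ht => ?_, fun s hs => ?_⟩
    · obtain rfl : t = 0 := by simpa using ht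
      simpa [cube_zero] using h1
    · obtain ⟨x, rfl⟩ := Multiset.card_eq_one.mp hs
      rw [← Multiset.cons_zero x, cube_cons']
      simp [iterDiff, h1]
  | succ m hm ih =>
    have hCi : ∀ i, IsCubicMultiset m (fun s => C (gen i ::ₘ s)) := fun i =>
      { one_cons := fun s hs => by
          rw [Multiset.cons_swap]
          exact hC.one_cons _ (by simp [hs])
        cocycle := fun x y z s hs => by
          have := hC.cocycle x y z (gen i ::ₘ s) (by simp; omega)
          simpa only [Multiset.cons_swap _ (gen i)] using this }
    choose d hdn hd using fun i => ih (hCi i)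
    have hcompat : ∀ i j, diff (gen j) (d i) = diff (gen i) (d j) := by
      intro i j
      obtain rfl | hm' := hm.eq_or_lt
      · have key : ∀ i x, d i x = C (gen i ::ₘ x ::ₘ 0) := fun i x => by
          have h1 := hd i {x} (by simp)
          have h2 := hdn i 0 (by simp)
          rw [Multiset.map_zero, cube_zero] at h2
          rw [← Multiset.cons_zero x, cube_cons'] at h1
          simpa [iterDiff, h2] using h1.symm
        funext x
        have e1 := hC.cocycle (gen i) (gen j) x 0 (by simp)
        have e2 := hC.cocycle (gen j) (gen i) x 0 (by simp)
        rw [mul_comm (gen j) (gen i), Multiset.cons_swap (gen j) (gen i)] at e2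
        simp only [diff, key]
        rw [sub_eq_sub_iff_add_eq_add]
        rw [← e1, e2]
      · obtain ⟨m, rfl⟩ := Nat.exists_eq_add_of_lt hm'
        have hm1 : 1 + m + 1 = (m + 1) + 1 := by omega
        rw [hm1] at hdn hd
        refine sub_eq_zero.mp (IsNormalized.eq_zero (m := m + 1) (by omega) (fun t ht => ?_)
          fun s hs => ?_)
        · rw [cube_sub, (hdn i).diff j t ht, (hdn j).diff i t ht, sub_zero]
        · rw [cube_sub, ← cube_cons, ← cube_cons, ← hd i _ (by simp [hs]),
            ← hd j _ (by simp [hs]), Multiset.cons_swap, sub_self]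
    obtain ⟨b, hb1, hb⟩ := exists_potential d hcompat
    refine ⟨b, fun t ht => ?_, ?_⟩
    · induction t using Multiset.induction with
      | empty => simpa [cube_zero] using hb1
      | cons i t _ =>
        rw [Multiset.map_cons, cube_cons, hb]
        exact hdn i t (by simpa using ht)
    · have hgen : ∀ i s, s.card = m → C (gen i ::ₘ s) = cube b (gen i ::ₘ s) := fun i s hs => by
        rw [cube_cons, hb]
        exact hd i s hs
      have key : ∀ p s, s.card = m → C (p ::ₘ s) = cube b (p ::ₘ s) := by
        intro p
        induction p using free_induction with
        | one => exact fun s hs => by rw [hC.one_cons s (by simp [hs]), cube_one_cons]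
        | mul i p ihp =>
          intro s hs
          obtain ⟨z, s, rfl⟩ : ∃ z s', s = z ::ₘ s' := by
            obtain ⟨z, hz⟩ := Multiset.card_pos_iff_exists_mem.mp (hs ▸ hm)
            exact ⟨z, Multiset.exists_cons_of_mem hz⟩
          have hs' : s.card + 1 = m := by simpa using hs
          have e1 := hC.cocycle (gen i) p z s (by omega)
          have e2 := cube_cocycle b (gen i) p z s
          rw [hgen i (p ::ₘ s) (by simpa using hs'), hgen i ((p * z) ::ₘ s) (by simpa using hs'),
            ihp (z ::ₘ s) hs, ← e2] at e1
          exact add_right_cancel e1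
      intro s hs
      obtain ⟨z, hz⟩ := Multiset.card_pos_iff_exists_mem.mp (hs.symm ▸ Nat.succ_pos m : 0 < s.card)
      obtain ⟨s, rfl⟩ := Multiset.exists_cons_of_mem hz
      exact key z s (by simpa using hs)

end Free

/-! ### Tuples, their permutations, and inclusion–exclusion -/

section Tuples

variable {P Q : Type*} [AddCommGroup Q] {n : ℕ}

theorem map_univ_insertNth (i : Fin (n + 1)) (x : P) (χ : Fin n → P) :
    Finset.univ.val.map (i.insertNth (α := fun _ => P) x χ) = x ::ₘ Finset.univ.val.map χ := by
  rw [Fin.univ_succAbove n i, Finset.cons_val, Multiset.map_cons, Fin.insertNth_apply_same,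
    Finset.map_val, Multiset.map_map]
  congr 1
  refine Multiset.map_congr rfl fun j _ => ?_
  exact Fin.insertNth_apply_succAbove (α := fun _ => P) i x χ j

theorem map_univ_update (i : Fin n) (x : P) (χ : Fin n → P) :
    Finset.univ.val.map (Function.update χ i x) =
      x ::ₘ (Finset.univ.erase i).val.map χ := by
  rw [← Finset.insert_erase (Finset.mem_univ i),
    Finset.insert_val_of_notMem (Finset.notMem_erase i _), Multiset.map_cons,
    Function.update_self]
  congr 1
  rw [Finset.insert_erase (Finset.mem_univ i)]
  refine Multiset.map_congr rfl fun j hj => ?_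
  exact Function.update_of_ne (Finset.ne_of_mem_erase (Finset.mem_def.mpr hj)) _ _

theorem map_univ_comp_perm (χ : Fin n → P) (σ : Equiv.Perm (Fin n)) :
    Finset.univ.val.map (χ ∘ σ) = Finset.univ.val.map χ := by
  rw [← Multiset.map_map]
  congr 1
  exact congrArg Finset.val (Finset.map_univ_equiv σ)

theorem map_univ_succ (f : Fin (n + 1) → P) :
    Finset.univ.val.map f = f 0 ::ₘ Finset.univ.val.map (fun i : Fin n => f i.succ) := by
  rw [← map_univ_insertNth 0, Fin.insertNth_zero']
  exact congrArg (Finset.univ.val.map ·) (Fin.cons_self_tail f).symm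

/-- Two tuples with the same multiset of entries differ by a permutation. -/
theorem exists_perm_of_map_univ_eq {f g : Fin n → P}
    (h : Finset.univ.val.map f = Finset.univ.val.map g) :
    ∃ σ : Equiv.Perm (Fin n), f = g ∘ σ := by
  classical
  have hc : ∀ p, Nonempty ({i // f i = p} ≃ {i // g i = p}) := fun p => by
    refine Fintype.card_eq.mp ?_
    have := congrArg (Multiset.count p) h
    rw [Multiset.count_map, Multiset.count_map] at this
    rw [Fintype.card_subtype, Fintype.card_subtype]
    simpa [Finset.card, eq_comm] using this
  refine ⟨Equiv.ofFiberEquiv fun p => (hc p).some, ?_⟩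
  funext i
  exact (Equiv.ofFiberEquiv_map _ i).symm

/-- Inclusion–exclusion: only the bijective `p : {1, …, n} → {1, …, n}` contribute to the
alternating sum of the sums over the maps `p : {1, …, n} → S`. -/
theorem sum_sum_tuple (E : (Fin n → P) → Q) (hE : ∀ χ (σ : Equiv.Perm (Fin n)), E (χ ∘ σ) = E χ)
    (χ : Fin n → P) :
    ∑ S : Finset (Fin n), ((-1 : ℤ) ^ (n - S.card)) • ∑ p : Fin n → S, E (fun k => χ (p k)) =
      n.factorial • E χ := by
  classical
  have h1 : ∀ S : Finset (Fin n), ∑ p : Fin n → S, E (fun k => χ (p k)) =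
      ∑ p : Fin n → Fin n, if (Finset.univ.image p) ⊆ S then E (χ ∘ p) else 0 := by
    intro S
    rw [← Finset.sum_filter]
    refine Finset.sum_bij (fun p _ k => (p k).1) ?_ ?_ ?_ ?_
    · intro p _
      simp [Finset.subset_iff]
    · intro p _ q _ h
      funext k
      exact Subtype.ext (congrFun h k)
    · intro p hp
      have hp' : ∀ k, p k ∈ S := by simpa [Finset.subset_iff] using hp
      exact ⟨fun k => ⟨p k, hp' k⟩, Finset.mem_univ _, rfl⟩
    · intro p _
      rfl
  have h2 : ∀ p : Fin n → Fin n, ∑ S : Finset (Fin n), ((-1 : ℤ) ^ (n - S.card)) •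
      (if (Finset.univ.image p) ⊆ S then E (χ ∘ p) else 0) =
      if Finset.univ.image p = Finset.univ then E (χ ∘ p) else 0 := by
    intro p
    have h3 : ∑ S : Finset (Fin n), ((-1 : ℤ) ^ (n - S.card)) •
        (if (Finset.univ.image p) ⊆ S then E (χ ∘ p) else 0) =
        ∑ T ∈ (Finset.univ.image p)ᶜ.powerset, ((-1 : ℤ) ^ T.card) • E (χ ∘ p) := by
      simp only [smul_ite, smul_zero]
      rw [← Finset.sum_filter]
      refine Finset.sum_bij' (fun S _ => Sᶜ) (fun T _ => Tᶜ) ?_ ?_ ?_ ?_ ?_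
      · intro S hS
        simpa using hS
      · intro T hT
        simpa [Finset.subset_compl_comm] using hT
      · simp
      · simp
      · intro S _
        rw [Finset.card_compl, Fintype.card_fin]
    rw [h3, ← Finset.sum_smul, Finset.sum_powerset_neg_one_pow_card]
    simp [Finset.compl_eq_empty_iff]
  simp only [h1, Finset.smul_sum]
  rw [Finset.sum_comm, Finset.sum_congr rfl fun p _ => h2 p, ← Finset.sum_filter]
  have h4 : ∀ p ∈ Finset.univ.filter (fun p : Fin n → Fin n => Finset.univ.image p = Finset.univ),
      E (χ ∘ p) = E χ := by
    intro p hp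
    have hs : Function.Surjective p := by
      rw [← Set.range_eq_univ, ← Finset.coe_univ, ← (Finset.mem_filter.mp hp).2]
      simp
    exact hE χ (Equiv.ofBijective p (Finite.surjective_iff_bijective.mp hs))
  rw [Finset.sum_congr rfl h4, Finset.sum_const]
  congr 1
  have h5 : n.factorial = (Finset.univ : Finset (Equiv.Perm (Fin n))).card := by
    rw [Finset.card_univ, Fintype.card_perm, Fintype.card_fin]
  rw [h5]
  symm
  refine Finset.card_bij (fun σ _ => (σ : Fin n → Fin n)) ?_ ?_ ?_
  · intro σ _
    simp [Finset.image_univ_equiv]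
  · intro σ _ τ _ h
    exact Equiv.coe_fn_injective h
  · intro p hp
    have hs : Function.Surjective p := by
      rw [← Set.range_eq_univ, ← Finset.coe_univ, ← (Finset.mem_filter.mp hp).2]
      simp
    exact ⟨Equiv.ofBijective p (Finite.surjective_iff_bijective.mp hs), Finset.mem_univ _, rfl⟩

end Tuples

/-! ### The structure `ξ^♭` on coordinates -/

section FlatLog

variable {P Q : Type*} [CommMonoid P] [AddCommGroup Q] {n : ℕ}

/-- The alternating sum `θ_n(b)(χ) = ∑_I (-1)^{n - #I} b(∑_{i ∈ I} χ_i)`. -/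
def tupleCube (b : P → Q) (χ : Fin n → P) : Q := cube b (Finset.univ.val.map χ)

/-- The additive version of `compCoord`. -/
def compLog (c : (Fin (n + 1) → P) → Q) (i : Fin n) (χ : Fin n → P) : List P → Q
  | [] => 0
  | [_] => 0
  | x :: y :: l =>
    c (i.castSucc.insertNth (α := fun _ => P) x (Function.update χ i (y :: l).prod)) +
      compLog c i χ (y :: l)

/-- The additive version of `multCoord`. -/
def multLog (c : (Fin (n + 1) → P) → Q) (χ : Fin n → P) (S : Finset (Fin n)) : Q :=
  ∑ j : Fin n, ∑ p : ({k : Fin n // k < j} → S),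
    compLog c j (fun k => if h : k < j then χ (p ⟨k, h⟩) else ∏ i ∈ S, χ i)
      ((S.sort (· ≤ ·)).map χ)

/-- The coordinate of `ξ^♭`, written additively, in terms of the coordinate `c` of `ξ`. -/
def flatLog (c : (Fin (n + 1) → P) → Q) (χ : Fin n → P) : Q :=
  ∑ S : Finset (Fin n), ((-1 : ℤ) ^ (n - S.card)) • multLog c χ S

/-- The change of coordinates of `L^♭` induced by a change of coordinates `b` of `L`. -/
def flatFun (n : ℕ) (b : P → Q) : P → Q := fun x =>
  tupleCube b (fun _ : Fin n => x) - n.factorial • b x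

theorem tupleCube_eq_sum (b : P → Q) (χ : Fin n → P) :
    tupleCube b χ = ∑ I : Finset (Fin n), ((-1 : ℤ) ^ (n - I.card)) • b (∏ i ∈ I, χ i) := by
  rw [tupleCube, cube_eq_sum, Finset.powerset_univ, Finset.card_univ, Fintype.card_fin]

theorem compLog_tupleCube (b : P → Q) (i : Fin n) (χ : Fin n → P) (l : List P) :
    compLog (tupleCube b) i χ l = tupleCube b (Function.update χ i l.prod) -
      (l.map fun x => tupleCube b (Function.update χ i x)).sum := by
  induction l with
  | nil => rw [tupleCube, List.prod_nil, map_univ_update, cube_one_cons]; simp [compLog]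
  | cons x l ih =>
    cases l with
    | nil => simp [compLog]
    | cons y l =>
      rw [compLog, ih, List.map_cons (a := x), List.sum_cons, List.prod_cons (a := x)]
      simp only [tupleCube, map_univ_insertNth, map_univ_update, cube_cons_cons]
      abel

theorem multLog_tupleCube (b : P → Q) (χ : Fin n → P) (S : Finset (Fin n)) :
    multLog (tupleCube b) χ S = tupleCube b (fun _ : Fin n => ∏ i ∈ S, χ i) -
      ∑ p : Fin n → S, tupleCube b (fun k => χ (p k)) := by
  -- `U m` is the sum over the tuples in which the first `m` places have been expanded
  let U : ℕ → Q := fun m => ∑ p : ({k : Fin n // k.val < m} → S),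
    tupleCube b (fun k => if h : k.val < m then χ (p ⟨k, h⟩) else ∏ i ∈ S, χ i)
  have hstep : ∀ j : Fin n, (∑ p : ({k : Fin n // k < j} → S),
      compLog (tupleCube b) j (fun k => if h : k < j then χ (p ⟨k, h⟩) else ∏ i ∈ S, χ i)
        ((S.sort (· ≤ ·)).map χ)) = U j.val - U (j.val + 1) := by
    intro j
    have hU : U (j.val + 1) = ∑ p : ({k : Fin n // k < j} → S), ∑ i : S, tupleCube b
        (Function.update (fun k => if h : k < j then χ (p ⟨k, h⟩) else ∏ i ∈ S, χ i) j (χ i)) := by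
      rw [← Fintype.sum_prod_type']
      refine Fintype.sum_equiv
        { toFun := fun q => (fun k => q ⟨k.1, Nat.lt_succ_of_lt k.2⟩, q ⟨j, Nat.lt_succ_self _⟩)
          invFun := fun q k => if h : k.1 < j then q.1 ⟨k.1, h⟩ else q.2
          left_inv := fun q => ?_
          right_inv := fun q => ?_ } _ _ fun q => ?_
      · funext k
        by_cases h : k.1 < j
        · simp [h]
        · have : k.1 = j := le_antisymm (Nat.lt_succ_iff.mp k.2) (not_lt.mp h)
          simp [← this]
      · refine Prod.ext (funext fun k => ?_) ?_
        · exact dif_pos k.2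
        · exact dif_neg (lt_irrefl j)
      · congr 1
        funext k
        rcases lt_trichotomy k j with h | h | h
        · have h' : k.val < j.val + 1 := Nat.lt_succ_of_lt h
          rw [dif_pos h', Function.update_of_ne h.ne, dif_pos h]
          rfl
        · subst h
          rw [Function.update_self, dif_pos (Nat.lt_succ_self _)]
          rfl
        · have h' : ¬ k.val < j.val + 1 := not_lt.mpr h
          rw [dif_neg h', Function.update_of_ne h.ne', dif_neg h.not_gt]
    rw [hU]
    change _ = (∑ p : ({k : Fin n // k < j} → S),
      tupleCube b (fun k => if h : k < j then χ (p ⟨k, h⟩) else ∏ i ∈ S, χ i)) - _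
    rw [← Finset.sum_sub_distrib]
    refine Finset.sum_congr rfl fun p _ => ?_
    have hsort : ∀ {M : Type _} [CommMonoid M] (f : Fin n → M),
        ((S.sort (· ≤ ·)).map f).prod = ∏ i ∈ S, f i := fun f => by
      rw [Finset.prod_eq_multiset_prod, ← Finset.sort_eq S (· ≤ ·), Multiset.map_coe,
        Multiset.prod_coe]
    have hsort' : ∀ (f : Fin n → Q), ((S.sort (· ≤ ·)).map f).sum = ∑ i ∈ S, f i := fun f => by
      rw [Finset.sum_eq_multiset_sum, ← Finset.sort_eq S (· ≤ ·), Multiset.map_coe,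
        Multiset.sum_coe]
    rw [compLog_tupleCube, hsort, List.map_map, hsort', Finset.sum_coe_sort S (fun i => tupleCube b
        (Function.update (fun k => if h : k < j then χ (p ⟨k, h⟩) else ∏ i ∈ S, χ i) j (χ i)))]
    congr 2
    rw [Function.update_eq_self_iff, dif_neg (lt_irrefl j)]
  have h0 : U 0 = tupleCube b (fun _ : Fin n => ∏ i ∈ S, χ i) := by
    have : IsEmpty {k : Fin n // k.val < 0} := ⟨fun k => Nat.not_lt_zero _ k.2⟩
    simp only [U]
    rw [Fintype.sum_unique]
    congr 1
  have hn : U n = ∑ p : Fin n → S, tupleCube b (fun k => χ (p k)) := by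
    refine Fintype.sum_equiv ((Equiv.subtypeUnivEquiv fun k : Fin n => k.2).arrowCongr
      (Equiv.refl _)) _ _ fun q => ?_
    congr 1
    funext k
    rw [dif_pos k.2]
    rfl
  rw [multLog, Finset.sum_congr rfl fun j _ => hstep j,
    Fin.sum_univ_eq_sum_range (fun j => U j - U (j + 1)) n, Finset.sum_range_sub', h0, hn]

/-- If `ξ` is the coboundary `θ_{n+1}(b)` then `ξ^♭` is the coboundary `θ_n(b^♭)`. -/
theorem flatLog_tupleCube (b : P → Q) (χ : Fin n → P) :
    flatLog (tupleCube b) χ = tupleCube (flatFun n b) χ := by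
  have h1 : tupleCube (flatFun n b) χ =
      tupleCube (fun x => tupleCube b (fun _ : Fin n => x)) χ - n.factorial • tupleCube b χ := by
    rw [tupleCube, tupleCube, tupleCube, ← cube_nsmul, ← cube_sub]
    rfl
  rw [h1, ← sum_sum_tuple (tupleCube b) (fun χ σ => by
    rw [tupleCube, map_univ_comp_perm, tupleCube]), tupleCube_eq_sum, ← Finset.sum_sub_distrib]
  refine Finset.sum_congr rfl fun S _ => ?_
  rw [multLog_tupleCube, smul_sub]

theorem compLog_add (c c' : (Fin (n + 1) → P) → Q) (i : Fin n) (χ : Fin n → P) (l : List P) :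
    compLog (c + c') i χ l = compLog c i χ l + compLog c' i χ l := by
  induction l with
  | nil => simp [compLog]
  | cons x l ih =>
    cases l with
    | nil => simp [compLog]
    | cons y l =>
      simp only [compLog, ih, Pi.add_apply]
      abel

theorem flatLog_add (c c' : (Fin (n + 1) → P) → Q) (χ : Fin n → P) :
    flatLog (c + c') χ = flatLog c χ + flatLog c' χ := by
  simp only [flatLog, multLog, compLog_add, Finset.sum_add_distrib, smul_add]

theorem compLog_map {Q' : Type*} [AddCommGroup Q'] (g : Q →+ Q') (c : (Fin (n + 1) → P) → Q)
    (i : Fin n) (χ : Fin n → P) (l : List P) :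
    compLog (fun χ' => g (c χ')) i χ l = g (compLog c i χ l) := by
  induction l with
  | nil => simp [compLog]
  | cons x l ih =>
    cases l with
    | nil => simp [compLog]
    | cons y l => simp only [compLog, ih, map_add]

theorem flatLog_map {Q' : Type*} [AddCommGroup Q'] (g : Q →+ Q') (c : (Fin (n + 1) → P) → Q)
    (χ : Fin n → P) : flatLog (fun χ' => g (c χ')) χ = g (flatLog c χ) := by
  simp only [flatLog, multLog, compLog_map, map_sum, map_zsmul]

theorem compLog_comp {P' : Type*} [CommMonoid P'] (π : P' →* P) (c : (Fin (n + 1) → P) → Q)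
    (i : Fin n) (χ : Fin n → P') (l : List P') :
    compLog (fun χ' => c (π ∘ χ')) i χ l = compLog c i (π ∘ χ) (l.map π) := by
  induction l with
  | nil => simp [compLog]
  | cons x l ih =>
    cases l with
    | nil => simp [compLog]
    | cons y l =>
      simp only [compLog, ih, List.map_cons]
      congr 2
      rw [← List.map_cons, ← map_list_prod, ← Function.comp_update]
      generalize Function.update χ i (y :: l).prod = χ'
      funext k
      rcases Fin.eq_self_or_eq_succAbove i.castSucc k with h | ⟨j, h⟩
      · subst h
        simp
      · subst h
        simp

theorem flatLog_comp {P' : Type*} [CommMonoid P'] (π : P' →* P) (c : (Fin (n + 1) → P) → Q)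
    (χ : Fin n → P') : flatLog (fun χ' => c (π ∘ χ')) χ = flatLog c (π ∘ χ) := by
  simp only [flatLog, multLog, compLog_comp, List.map_map]
  refine Finset.sum_congr rfl fun S _ => ?_
  congr 1
  refine Finset.sum_congr rfl fun j _ => Finset.sum_congr rfl fun p _ => ?_
  congr 1
  funext k
  simp only [Function.comp_apply]
  split_ifs
  · rfl
  · rw [map_prod]

end FlatLog

/-! ### Hypercubic functions on tuples -/

section CubicFun

variable {P : Type u} {Q : Type*} [CommMonoid P] [AddCommGroup Q] {n : ℕ}

/-- The conditions of an `n`-cubic structure for a function on `n`-tuples. -/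
structure IsCubicFun (c : (Fin n → P) → Q) : Prop where
  rigid : c (fun _ => 1) = 0
  symm : ∀ (χ : Fin n → P) (σ : Equiv.Perm (Fin n)), c (fun i => χ (σ i)) = c χ
  cocycle : ∀ χ : Fin (n + 1) → P,
    c (mapA χ) + c (mapB χ) = c (mapC χ) + c (mapD χ)

theorem IsCubicFun.add {c c' : (Fin n → P) → Q} (h : IsCubicFun c) (h' : IsCubicFun c') :
    IsCubicFun (c + c') where
  rigid := by simp [h.rigid, h'.rigid]
  symm χ σ := by simp [h.symm χ σ, h'.symm χ σ]
  cocycle χ := by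
    simp only [Pi.add_apply]
    rw [add_add_add_comm, h.cocycle, h'.cocycle, add_add_add_comm]

theorem map_univ_mapA (χ : Fin (n + 3) → P) : Finset.univ.val.map (mapA χ) =
    (χ 0 * χ 1) ::ₘ χ 2 ::ₘ Finset.univ.val.map (fun i : Fin n => χ i.succ.succ.succ) := by
  rw [map_univ_succ, map_univ_succ]
  rfl

theorem map_univ_mapB {P : Type u} (χ : Fin (n + 3) → P) : Finset.univ.val.map (mapB χ) =
    χ 0 ::ₘ χ 1 ::ₘ Finset.univ.val.map (fun i : Fin n => χ i.succ.succ.succ) := by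
  rw [map_univ_succ, map_univ_succ]
  rfl

theorem map_univ_mapC (χ : Fin (n + 3) → P) : Finset.univ.val.map (mapC χ) =
    χ 0 ::ₘ (χ 1 * χ 2) ::ₘ Finset.univ.val.map (fun i : Fin n => χ i.succ.succ.succ) := by
  rw [map_univ_succ, map_univ_succ]
  rfl

theorem map_univ_mapD {P : Type u} (χ : Fin (n + 3) → P) : Finset.univ.val.map (mapD χ) =
    χ 1 ::ₘ χ 2 ::ₘ Finset.univ.val.map (fun i : Fin n => χ i.succ.succ.succ) := by
  rw [map_univ_succ, map_univ_succ]
  rfl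

theorem isCubicFun_tupleCube (hn : 2 ≤ n) (b : P → Q) :
    IsCubicFun (n := n) (tupleCube b) where
  rigid := by
    obtain ⟨n, rfl⟩ := Nat.exists_eq_add_of_le' hn
    rw [tupleCube, Fin.univ_succ, Finset.cons_val, Multiset.map_cons, cube_one_cons]
  symm χ σ := congrArg (cube b) (map_univ_comp_perm χ σ)
  cocycle χ := by
    obtain ⟨n, rfl⟩ := Nat.exists_eq_add_of_le' hn
    rw [tupleCube, tupleCube, tupleCube, tupleCube, map_univ_mapA, map_univ_mapB, map_univ_mapC,
      map_univ_mapD]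
    exact cube_cocycle b _ _ _ _

theorem IsCubicFun.exists_multiset (hn : 2 ≤ n) {c : (Fin n → P) → Q} (hc : IsCubicFun c) :
    ∃ C : Multiset P → Q, IsCubicMultiset n C ∧
      ∀ χ : Fin n → P, c χ = C (Finset.univ.val.map χ) := by
  let C : Multiset P → Q := Function.extend (fun χ : Fin n → P => Finset.univ.val.map χ) c 0
  have hC : ∀ χ : Fin n → P, c χ = C (Finset.univ.val.map χ) := fun χ =>
    (Function.FactorsThrough.extend_apply
      (f := fun χ : Fin n → P => Finset.univ.val.map χ) (g := c) (fun f g h => by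
        obtain ⟨σ, rfl⟩ := exists_perm_of_map_univ_eq h
        exact hc.symm g σ) 0 χ).symm
  obtain ⟨n, rfl⟩ := Nat.exists_eq_add_of_le' hn
  have hex : ∀ s : Multiset P, ∃ (k : ℕ) (f : Fin k → P), Finset.univ.val.map f = s := fun s => by
    induction s using Multiset.induction with
    | empty => exact ⟨0, Fin.elim0, rfl⟩
    | cons x s ih =>
      obtain ⟨k, f, rfl⟩ := ih
      exact ⟨k + 1, Fin.cons x f, map_univ_succ _⟩
  have hco : ∀ (x y z : P) (s : Multiset P), s.card + 2 = n + 2 →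
      C ((x * y) ::ₘ z ::ₘ s) + C (x ::ₘ y ::ₘ s) =
        C (x ::ₘ (y * z) ::ₘ s) + C (y ::ₘ z ::ₘ s) := by
    intro x y z s hs
    obtain ⟨k, f, hf⟩ := hex s
    obtain rfl : k = n := by simpa [← hf] using hs
    have := hc.cocycle (Fin.cons x (Fin.cons y (Fin.cons z f)))
    rw [hC, hC, hC, hC, map_univ_mapA, map_univ_mapB, map_univ_mapC, map_univ_mapD] at this
    simp only [Fin.cons_zero, Fin.cons_succ, hf] at this
    exact this
  refine ⟨C, ⟨?_, hco⟩, hC⟩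
  -- the cocycle condition for `(1, 1, z)` replaces the entries by `1` one after the other
  have key : ∀ (s : Multiset P) (k : ℕ), s.card + (k + 1) = n + 2 →
      C (Multiset.replicate (k + 1) 1 + s) = 0 := by
    intro s
    induction s using Multiset.induction with
    | empty =>
      intro k hk
      have hk' : k + 1 = n + 2 := by simpa using hk
      rw [hk', add_zero, ← hc.rigid, hC]
      simp
    | cons z s ih =>
      intro k hk
      rw [Multiset.card_cons] at hk
      have h1 := hco 1 1 z (Multiset.replicate k 1 + s) (by simp; omega)
      rw [one_mul, one_mul, add_right_inj] at h1
      have h2 := ih (k + 1) (by omega)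
      rw [Multiset.replicate_succ, Multiset.replicate_succ] at h2
      rw [Multiset.replicate_succ, Multiset.cons_add, Multiset.add_cons, ← h1]
      simpa using h2
  intro s hs
  simpa using key s 0 (by omega)

/-- If `ξ` is `(n + 1)`-cubic then `ξ^♭` is `n`-cubic.  After pulling back to a free commutative
monoid, `ξ` becomes a coboundary, so that `ξ^♭` is a coboundary, too. -/
theorem IsCubicFun.flatLog (hn : 2 ≤ n) {c : (Fin (n + 1) → P) → Q} (hc : IsCubicFun c) :
    IsCubicFun (flatLog c) := by
  obtain ⟨C, hC, hcC⟩ := hc.exists_multiset (by omega)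
  have key : ∀ {ι : Type} (π : Multiplicative (Multiset ι) →* P),
      IsCubicFun fun χ : Fin n → Multiplicative (Multiset ι) => Hypercubic.flatLog c (π ∘ χ) := by
    intro ι π
    have hCπ : IsCubicMultiset (n + 1) fun s => C (s.map π) :=
      ⟨fun s hs => by simpa using hC.one_cons (s.map π) (by simpa using hs),
        fun x y z s hs => by
          simpa using hC.cocycle (π x) (π y) (π z) (s.map π) (by simpa using hs)⟩
    obtain ⟨b, -, hb⟩ := exists_eq_cube (by omega) hCπ
    have : (fun χ : Fin (n + 1) → Multiplicative (Multiset ι) => c (π ∘ χ)) = tupleCube b := by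
      funext χ
      rw [hcC, ← Multiset.map_map, tupleCube, ← hb _ (by simp)]
    have h2 : (fun χ : Fin n → Multiplicative (Multiset ι) => Hypercubic.flatLog c (π ∘ χ)) =
        tupleCube (flatFun n b) := by
      funext χ
      rw [← flatLog_comp, this, flatLog_tupleCube]
    rw [h2]
    exact isCubicFun_tupleCube hn _
  have hfree : ∀ {ι : Type} (f : ι → P), ∃ π : Multiplicative (Multiset ι) →* P,
      ∀ i, π (gen i) = f i := fun {ι} f =>
    ⟨{ toFun := fun p => (p.toAdd.map f).prod
       map_one' := by simp
       map_mul' := fun p q => by simp }, fun i => by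
        change (Multiset.map f {i}).prod = f i
        simp⟩
  refine ⟨?_, fun χ σ => ?_, fun χ => ?_⟩
  · have := (key (ι := Empty) 1).rigid
    exact this
  · obtain ⟨π, hπ⟩ := hfree χ
    have := (key π).symm gen σ
    simp only [Function.comp_def, hπ] at this
    exact this
  · obtain ⟨π, hπ⟩ := hfree χ
    have hA : π ∘ mapA gen = mapA χ := by funext i; simp [mapA, apply_ite π, hπ]
    have hB : π ∘ mapB gen = mapB χ := by funext i; simp [mapB, apply_ite π, hπ]
    have hC : π ∘ mapC gen = mapC χ := by funext i; simp [mapC, apply_ite π, hπ]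
    have hD : π ∘ mapD gen = mapD χ := by funext i; simp [mapD, hπ]
    have := (key π).cocycle gen
    simpa only [hA, hB, hC, hD] using this

end CubicFun

/-! ### Coordinate functions on invertible modules -/

section Coordinates

variable {A T T' : Type u} [CommRing A] [CommRing T] [CommRing T']

/-- A semilinear function `φ` on `M` with values in `T` is a coordinate of a trivialization of the
pull-back of `M` to `T` as soon as its values generate the unit ideal. -/
theorem exists_coordPos_eq (f : A →+* T) (M : ModuleCat.{u} A) [Module.Invertible A M]
    (φ : M →ₛₗ[f] T) (hφ : Ideal.span (Set.range φ) = ⊤) :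
    ∃ e : pullback f M ≃ₗ[T] T, ∀ m, coordPos f e m = φ m := by
  let := f.toAlgebra
  let φ' : M →ₗ[A] T :=
    { toFun := φ
      map_add' := φ.map_add
      map_smul' := fun a m => by
        rw [LinearMap.map_smulₛₗ, RingHom.id_apply, Algebra.smul_def]; rfl }
  let F : T ⊗[A] M →ₗ[T] T := LinearMap.liftBaseChange T φ'
  have hF : ∀ m, F (1 ⊗ₜ m) = φ m := fun m => by
    rw [LinearMap.liftBaseChange_tmul, one_smul]
    rfl
  have hs : Function.Surjective F := by
    rw [← LinearMap.range_eq_top, eq_top_iff]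
    refine hφ.ge.trans (Submodule.span_le.mpr ?_)
    rintro _ ⟨m, rfl⟩
    exact ⟨_, hF m⟩
  exact ⟨LinearEquiv.ofBijective F (Module.Invertible.bijective_of_surjective hs), hF⟩

variable {f : A →+* T} {M : ModuleCat.{u} A}

/-- The sections `f^* m` generate `f^* M`. -/
theorem pullback_induction {motive : pullback f M → Prop} (zero : motive 0)
    (add : ∀ z w, motive z → motive w → motive (z + w))
    (smul : ∀ (t : T) (m : M), motive (t • pullbackSection f M m)) (z) : motive z := by
  let := f.toAlgebra
  have key : ∀ z : T ⊗[A] M, motive z := fun z => by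
    induction z using TensorProduct.induction_on with
    | zero => exact zero
    | tmul t m =>
      have : (t ⊗ₜ[A] m : T ⊗[A] M) = t • (1 ⊗ₜ[A] m) := by
        rw [TensorProduct.smul_tmul', smul_eq_mul, mul_one]
      rw [this]
      exact smul t m
    | add z w hz hw => exact add z w hz hw
  exact key z

theorem coordPos_apply (e : pullback f M ≃ₗ[T] T) (m : M) :
    coordPos f e m = e (pullbackSection f M m) := rfl

theorem span_range_coordPos (e : pullback f M ≃ₗ[T] T) :
    Ideal.span (Set.range (coordPos f e)) = ⊤ := by
  rw [Ideal.eq_top_iff_one, ← e.apply_symm_apply 1]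
  generalize e.symm 1 = z
  induction z using pullback_induction with
  | zero => simp
  | add z w hz hw => rw [map_add]; exact add_mem hz hw
  | smul t m =>
    rw [map_smul, smul_eq_mul]
    exact Ideal.mul_mem_left _ _ (Ideal.subset_span ⟨m, rfl⟩)

theorem eq_of_forall_mul_eq {ι : Type*} {φ : ι → T} (hφ : Ideal.span (Set.range φ) = ⊤) {a b : T}
    (h : ∀ m, a * φ m = b * φ m) : a = b := by
  have : ∀ t ∈ Ideal.span (Set.range φ), a * t = b * t := fun t ht => by
    induction ht using Submodule.span_induction with
    | mem t ht => obtain ⟨m, rfl⟩ := ht; exact h m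
    | zero => simp
    | add t s _ _ ht hs => rw [mul_add, mul_add, ht, hs]
    | smul r t _ ht => rw [smul_eq_mul, mul_left_comm, ht, mul_left_comm]
  simpa using this 1 (hφ ▸ Submodule.mem_top)

theorem pullbackForm_pullbackSection (ψ : Module.Dual A M) (m : M) :
    pullbackForm f ψ (pullbackSection f M m) = f (ψ m) := by
  let := f.toAlgebra
  change LinearMap.liftBaseChange T ((Algebra.linearMap A T).comp ψ) ((1 : T) ⊗ₜ[A] m) = f (ψ m)
  rw [LinearMap.liftBaseChange_tmul, one_smul]
  rfl

/-- The coordinates of `φ` and `m` multiply to the value `φ m`; this determines `coordNeg` in terms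
of `coordPos`. -/
theorem coordNeg_mul_coordPos (e : pullback f M ≃ₗ[T] T) (ψ : Module.Dual A M) (m : M) :
    coordNeg f e ψ * coordPos f e m = f (ψ m) := by
  rw [← pullbackForm_pullbackSection]
  have h : pullbackSection f M m = coordPos f e m • e.symm 1 := by
    rw [← map_smul, smul_eq_mul, mul_one, coordPos_apply, e.symm_apply_apply]
  conv_rhs => rw [h, map_smul, smul_eq_mul, mul_comm]
  rfl

theorem span_range_coordNeg [Module.Invertible A M] (e : pullback f M ≃ₗ[T] T) :
    Ideal.span (Set.range (coordNeg f e)) = ⊤ := by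
  -- write `1 = ∑ φ_i(m_i)`
  have h1 : (1 : A) ∈ Ideal.span (Set.range fun p : Module.Dual A M × M => p.1 p.2) := by
    rw [← (Module.Invertible.linearEquiv A M).apply_symm_apply 1]
    generalize (Module.Invertible.linearEquiv A M).symm 1 = z
    induction z using TensorProduct.induction_on with
    | zero => simp
    | tmul ψ m => exact Ideal.subset_span ⟨(ψ, m), rfl⟩
    | add z w hz hw => rw [map_add]; exact add_mem hz hw
  have h2 := Ideal.mem_map_of_mem f h1
  rw [map_one, Ideal.map_span] at h2
  rw [Ideal.eq_top_iff_one]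
  refine Ideal.span_le.mpr ?_ h2
  rintro _ ⟨_, ⟨⟨ψ, m⟩, rfl⟩, rfl⟩
  rw [← coordNeg_mul_coordPos e]
  exact Ideal.mul_mem_right _ _ (Ideal.subset_span ⟨ψ, rfl⟩)

section Tensor

variable {ι : Type} [Fintype ι] {N : ι → Type u} [∀ i, AddCommGroup (N i)] [∀ i, Module A (N i)]

theorem span_range_coordTensor {φ : ∀ i, N i →ₛₗ[f] T}
    (hφ : ∀ i, Ideal.span (Set.range (φ i)) = ⊤) :
    Ideal.span (Set.range (coordTensor f φ)) = ⊤ := by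
  have h : ∏ i, Ideal.span (Set.range (φ i)) = ⊤ := by simp [hφ, ← Ideal.one_eq_top]
  rw [Ideal.prod_span] at h
  rw [eq_top_iff, ← h]
  refine Ideal.span_mono ?_
  intro t ht
  obtain ⟨g, hg, rfl⟩ := (Set.mem_fintype_prod _ _).mp ht
  choose m hm using hg
  refine ⟨PiTensorProduct.tprod A m, ?_⟩
  rw [coordTensor_tprod]
  exact Finset.prod_congr rfl fun i _ => hm i

theorem coordTensor_eq_of_forall (g : T →+* T') {f' : A →+* T'} (hf : f' = g.comp f)
    {φ : ∀ i, N i →ₛₗ[f] T} {φ' : ∀ i, N i →ₛₗ[f'] T'} (u : ι → T')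
    (h : ∀ i m, φ' i m = u i * g (φ i m)) (w : ⨂[A] i, N i) :
    coordTensor f' φ' w = (∏ i, u i) * g (coordTensor f φ w) := by
  subst hf
  induction w using PiTensorProduct.induction_on with
  | smul_tprod a m =>
    rw [LinearMap.map_smulₛₗ, LinearMap.map_smulₛₗ, coordTensor_tprod, coordTensor_tprod,
      smul_eq_mul, smul_eq_mul, map_mul, map_prod, RingHom.comp_apply]
    simp only [h, Finset.prod_mul_distrib]
    ring
  | add z w hz hw => rw [map_add, map_add, map_add, hz, hw, mul_add]

end Tensor

theorem coordNeg_eq_of_forall (g : T →+* T') {f' : A →+* T'} (hf : f' = g.comp f)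
    {e : pullback f M ≃ₗ[T] T} {e' : pullback f' M ≃ₗ[T'] T'} (u : T'ˣ)
    (h : ∀ m, coordPos f' e' m = u * g (coordPos f e m)) (ψ : Module.Dual A M) :
    coordNeg f' e' ψ = ↑u⁻¹ * g (coordNeg f e ψ) := by
  refine eq_of_forall_mul_eq (span_range_coordPos e') fun m => ?_
  rw [coordNeg_mul_coordPos, h, hf, RingHom.comp_apply, ← coordNeg_mul_coordPos e, map_mul]
  rw [mul_mul_mul_comm, Units.inv_mul, one_mul]

theorem coordPow_eq_of_forall (g : T →+* T') {f' : A →+* T'} (hf : f' = g.comp f)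
    {e : pullback f M ≃ₗ[T] T} {e' : pullback f' M ≃ₗ[T'] T'} (u : T'ˣ)
    (h : ∀ m, coordPos f' e' m = u * g (coordPos f e m)) (k : ℤ) (w : tpow M k) :
    coordPow f' e' k w = ↑(u ^ k) * g (coordPow f e k w) := by
  cases k with
  | ofNat k =>
    refine (coordTensor_eq_of_forall g hf (fun _ => (u : T')) (fun _ => h) w).trans ?_
    congr 1
    simp
  | negSucc k =>
    refine (coordTensor_eq_of_forall g hf (fun _ => (↑u⁻¹ : T'))
      (fun _ => coordNeg_eq_of_forall g hf u h) w).trans ?_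
    congr 1
    rw [zpow_negSucc, ← inv_pow]
    simp

theorem span_range_coordPow [Module.Invertible A M] (e : pullback f M ≃ₗ[T] T) (k : ℤ) :
    Ideal.span (Set.range (coordPow f e k)) = ⊤ := by
  cases k with
  | ofNat k => exact span_range_coordTensor fun _ => span_range_coordPos e
  | negSucc k => exact span_range_coordTensor fun _ => span_range_coordNeg e

/-- Two trivializations of the same module differ by a unit. -/
theorem exists_unit_coordPos (e e' : pullback f M ≃ₗ[T] T) :
    ∃ u : Tˣ, ∀ m, coordPos f e' m = u * coordPos f e m := by
  have h : ∀ (e e' : pullback f M ≃ₗ[T] T) z, e' z = e' (e.symm 1) * e z := fun e e' z => by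
    conv_lhs => rw [← e.symm_apply_apply z, ← mul_one (e z), ← smul_eq_mul, map_smul, map_smul,
      smul_eq_mul, mul_comm]
  refine ⟨⟨e' (e.symm 1), e (e'.symm 1), ?_, ?_⟩, fun m => h e e' _⟩
  · rw [← h, e'.apply_symm_apply]
  · rw [← h, e.apply_symm_apply]

/-- Coordinates on a tensor product of two modules. -/
theorem exists_coord_tmul {M N : Type u} [AddCommGroup M] [Module A M] [AddCommGroup N]
    [Module A N] (φ : M →ₛₗ[f] T) (ψ : N →ₛₗ[f] T) (hφ : Ideal.span (Set.range φ) = ⊤)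
    (hψ : Ideal.span (Set.range ψ) = ⊤) :
    ∃ ω : M ⊗[A] N →ₛₗ[f] T, (∀ m n, ω (m ⊗ₜ n) = φ m * ψ n) ∧
      Ideal.span (Set.range ω) = ⊤ := by
  let := f.toAlgebra
  let lin : ∀ {X : Type u} [AddCommGroup X] [Module A X], (X →ₛₗ[f] T) → (X →ₗ[A] T) := fun φ =>
    { toFun := φ
      map_add' := φ.map_add
      map_smul' := fun a m => by
        rw [LinearMap.map_smulₛₗ, RingHom.id_apply, Algebra.smul_def]; rfl }
  let F : M ⊗[A] N →ₗ[A] T := (LinearMap.mul' A T).comp (TensorProduct.map (lin φ) (lin ψ))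
  let ω : M ⊗[A] N →ₛₗ[f] T :=
    { toFun := F
      map_add' := F.map_add
      map_smul' := fun a m => by
        rw [F.map_smul, Algebra.smul_def]; rfl }
  refine ⟨ω, fun m n => rfl, ?_⟩
  have h : Ideal.span (Set.range φ) * Ideal.span (Set.range ψ) = ⊤ := by
    rw [hφ, hψ, ← Ideal.one_eq_top, one_mul]
  rw [Ideal.span_mul_span'] at h
  rw [eq_top_iff, ← h]
  refine Ideal.span_mono ?_
  rintro _ ⟨_, ⟨m, rfl⟩, _, ⟨n, rfl⟩, rfl⟩
  exact ⟨m ⊗ₜ n, rfl⟩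

end Coordinates

/-! ### Invertibility and classes in the Picard group -/

section Pic

open CommRing

variable {A B : Type u} [CommRing A] [CommRing B]

theorem invertible_piTensorProduct_and_mk (ι : Type) [Fintype ι] (N : ι → Type u)
    [∀ i, AddCommGroup (N i)] [∀ i, Module A (N i)] [∀ i, Module.Invertible A (N i)] :
    ∃ _ : Module.Invertible A (⨂[A] i, N i), Pic.mk A (⨂[A] i, N i) = ∏ i, Pic.mk A (N i) := by
  refine Fintype.induction_empty_option (P := fun ι _ => ∀ (N : ι → Type u)
    [∀ i, AddCommGroup (N i)] [∀ i, Module A (N i)] [∀ i, Module.Invertible A (N i)],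
    ∃ _ : Module.Invertible A (⨂[A] i, N i), Pic.mk A (⨂[A] i, N i) = ∏ i, Pic.mk A (N i))
    ?_ ?_ ?_ ι N
  · intro α β _ e ih N _ _ _
    let := Fintype.ofEquiv β e.symm
    obtain ⟨h, hm⟩ := ih (fun i => N (e i))
    let E : (⨂[A] i, N i) ≃ₗ[A] ⨂[A] i, N (e i) := PiTensorProduct.reindex A N e.symm
    have h' : Module.Invertible A (⨂[A] i, N i) := .congr E.symm
    refine ⟨h', ?_⟩
    rw [Pic.mk_eq_mk_iff.mpr ⟨E⟩, hm]
    exact Fintype.prod_equiv e _ _ fun _ => rfl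
  · intro N _ _ _
    have h' : Module.Invertible A (⨂[A] i, N i) := .congr (PiTensorProduct.isEmptyEquiv PEmpty).symm
    refine ⟨h', ?_⟩
    rw [Finset.univ_eq_empty, Finset.prod_empty]
    exact Pic.mk_eq_one_iff.mpr ⟨PiTensorProduct.isEmptyEquiv PEmpty⟩
  · intro α _ ih N _ _ _
    obtain ⟨h, hm⟩ := ih (fun i => N (some i))
    let E : (⨂[A] i, N i) ≃ₗ[A] (⨂[A] i, N (some i)) ⊗[A] N none :=
      (PiTensorProduct.reindex A N (Equiv.optionEquivSumPUnit.{0} α)).trans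
        ((PiTensorProduct.tmulEquivDep A
          (fun i => N ((Equiv.optionEquivSumPUnit.{0} α).symm i))).symm.trans
          (TensorProduct.congr (LinearEquiv.refl A _)
            (PiTensorProduct.subsingletonEquiv PUnit.unit)))
    have h' : Module.Invertible A (⨂[A] i, N i) := .congr E.symm
    refine ⟨h', ?_⟩
    rw [Pic.mk_eq_mk_iff.mpr ⟨E⟩, Pic.mk_tensor, hm, Fintype.prod_option, mul_comm]

instance (ι : Type) [Fintype ι] (N : ι → Type u) [∀ i, AddCommGroup (N i)] [∀ i, Module A (N i)]
    [∀ i, Module.Invertible A (N i)] : Module.Invertible A (⨂[A] i, N i) :=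
  (invertible_piTensorProduct_and_mk ι N).1

theorem mk_piTensorProduct (ι : Type) [Fintype ι] (N : ι → Type u) [∀ i, AddCommGroup (N i)]
    [∀ i, Module A (N i)] [∀ i, Module.Invertible A (N i)] :
    Pic.mk A (⨂[A] i, N i) = ∏ i, Pic.mk A (N i) :=
  (invertible_piTensorProduct_and_mk ι N).2

instance (M : ModuleCat.{u} A) [Module.Invertible A M] (k : ℤ) :
    Module.Invertible A (tpow M k) := by
  cases k with
  | ofNat k => exact inferInstanceAs (Module.Invertible A (⨂[A] _ : Fin k, M))
  | negSucc k => exact inferInstanceAs (Module.Invertible A (⨂[A] _ : Fin (k + 1), Module.Dual A M))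

theorem mk_tpow (M : ModuleCat.{u} A) [Module.Invertible A M] (k : ℤ) :
    Pic.mk A (tpow M k) = Pic.mk A M ^ k := by
  cases k with
  | ofNat k =>
    refine (mk_piTensorProduct (Fin k) fun _ => M).trans ?_
    simp
  | negSucc k =>
    refine (mk_piTensorProduct (Fin (k + 1)) fun _ => Module.Dual A M).trans ?_
    simp [Pic.mk_dual, zpow_negSucc]

instance (f : A →+* B) (M : ModuleCat.{u} A) [Module.Invertible A M] :
    Module.Invertible B (pullback f M) :=
  letI := f.toAlgebra
  inferInstanceAs (Module.Invertible B (B ⊗[A] M))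

theorem mk_pullback (f : A →+* B) (M : ModuleCat.{u} A) [Module.Invertible A M] :
    Pic.mk B (pullback f M) = Pic.mapRingHom f (Pic.mk A M) := by
  let := f.toAlgebra
  refine Pic.mk_eq_mk_iff.mpr ⟨?_⟩
  exact TensorProduct.AlgebraTensorModule.congr (LinearEquiv.refl B B) (Pic.mk.linearEquiv A M).symm

end Pic

/-! ### Frames along a monoid of points -/

section Frames

variable {R : Type u} [CommRing R] {G : Type u} [CommGroup G]
variable {T T' : Type u} [CommRing T] [Algebra R T] [CommRing T'] [Algebra R T']
variable {P P' : Type*} [CommMonoid P] [CommMonoid P'] {n : ℕ}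
variable {L : ModuleCat.{u} (MonoidAlgebra R G)}

theorem pt_of (χ : G →* T) (g : G) : pt R χ (MonoidAlgebra.of R G g) = χ g := by
  simp [pt]

theorem ptPow_of (χ : Fin n → (G →* T)) (g : Fin n → G) :
    ptPow R χ (MonoidAlgebra.of R (Fin n → G) g) = ∏ i, χ i (g i) := by
  simp [ptPow]

theorem ptPow_comp_mHom (χ : Fin n → (G →* T)) (I : Finset (Fin n)) :
    (ptPow R χ).comp (mHom R G n I) = pt R (∏ i ∈ I, χ i) := by
  refine MonoidAlgebra.algHom_ext (fun g => ?_) (Subsingleton.elim _ _)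
  change ptPow R χ (pt R (∏ i ∈ I, univChar R G n i) (MonoidAlgebra.of R G g)) =
    pt R (∏ i ∈ I, χ i) (MonoidAlgebra.of R G g)
  rw [pt_of, pt_of, MonoidHom.finsetProd_apply, MonoidHom.finsetProd_apply, map_prod]
  refine Finset.prod_congr rfl fun i _ => ?_
  change ptPow R χ (MonoidAlgebra.of R (Fin n → G) (Pi.mulSingle i g)) = χ i g
  rw [ptPow_of, Finset.prod_eq_single i]
  · simp
  · intro j _ hj
    simp [hj]
  · simp

theorem pt_comp_diagHom (χ : G →* T) :
    (pt R χ).comp (diagHom R G n) = ptPow R (fun _ => χ) := by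
  refine MonoidAlgebra.algHom_ext (fun g => ?_) (Subsingleton.elim _ _)
  change pt R χ (ptPow R (fun _ => MonoidAlgebra.of R G) (MonoidAlgebra.of R (Fin n → G) g)) =
    ptPow R (fun _ => χ) (MonoidAlgebra.of R (Fin n → G) g)
  rw [ptPow_of, ptPow_of, map_prod]
  exact Finset.prod_congr rfl fun i _ => pt_of _ _

theorem exists_eq_pt (x : MonoidAlgebra R G →ₐ[R] T) : ∃ χ : G →* T, x = pt R χ :=
  ⟨(MonoidAlgebra.lift R T G).symm x, ((MonoidAlgebra.lift R T G).apply_symm_apply x).symm⟩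

/-- Trivializations of the pull-backs of `L` to `T` along a monoid `P` of `T`-valued points of `H`,
given by a homomorphism `ρ` from `P` to the group of these points. -/
abbrev FrameAlong (ρ : P →* (G →* T)) (L : ModuleCat.{u} (MonoidAlgebra R G)) : Type _ :=
  ∀ p : P, pullback (pt R (ρ p)).toRingHom L ≃ₗ[T] T

/-- Transport of a trivialization along an equality of ring homomorphisms. -/
def castTriv {A : Type u} [CommRing A] {f f' : A →+* T} {M : ModuleCat.{u} A} (h : f' = f)
    (e : pullback f M ≃ₗ[T] T) : pullback f' M ≃ₗ[T] T := h ▸ e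

theorem coordPos_castTriv {A : Type u} [CommRing A] {f f' : A →+* T} {M : ModuleCat.{u} A}
    (h : f' = f) (e : pullback f M ≃ₗ[T] T) (m : M) :
    coordPos f' (castTriv h e) m = coordPos f e m := by
  subst h
  rfl

/-- Coordinates on `f^* m^* L` in terms of those on `(m ∘ f)^* L`. -/
theorem coordPos_pullbackComp {A B : Type u} [CommRing A] [CommRing B] (m : A →+* B) (f : B →+* T)
    {M : ModuleCat.{u} A} (e : pullback (f.comp m) M ≃ₗ[T] T) (l : M) :
    coordPos f ((pullbackComp m f M).trans e) (pullbackSection m M l) =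
      coordPos (f.comp m) e l := by
  rw [coordPos_apply, coordPos_apply, LinearEquiv.trans_apply]
  congr 1
  let := m.toAlgebra
  let := f.toAlgebra
  let := (f.comp m).toAlgebra
  have : IsScalarTower A B T := IsScalarTower.of_algebraMap_eq (fun _ => rfl)
  change TensorProduct.AlgebraTensorModule.cancelBaseChange A B T T M
    ((1 : T) ⊗ₜ[B] ((1 : B) ⊗ₜ[A] l)) = (1 : T) ⊗ₜ[A] l
  simp

theorem coordPos_eq_of_forall_pullbackSection {A B : Type u} [CommRing A] [CommRing B]
    (m : A →+* B) {M : ModuleCat.{u} A} (g : T →+* T') {f : B →+* T} {f' : B →+* T'}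
    (hf : f' = g.comp f) {e : pullback f (pullback m M) ≃ₗ[T] T}
    {e' : pullback f' (pullback m M) ≃ₗ[T'] T'} (u : T')
    (h : ∀ l, coordPos f' e' (pullbackSection m M l) =
      u * g (coordPos f e (pullbackSection m M l))) (z : pullback m M) :
    coordPos f' e' z = u * g (coordPos f e z) := by
  subst hf
  induction z using pullback_induction with
  | zero => simp
  | add z w hz hw => rw [map_add, map_add, map_add, hz, hw, mul_add]
  | smul t l =>
    rw [LinearMap.map_smulₛₗ, LinearMap.map_smulₛₗ, h, smul_eq_mul, smul_eq_mul, map_mul,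
      RingHom.comp_apply, mul_left_comm]

theorem ptPow_comp_mHom_toRingHom (ρ : P →* (G →* T)) (χ : Fin n → P) (I : Finset (Fin n)) :
    (ptPow R (fun i => ρ (χ i))).toRingHom.comp (mHom R G n I).toRingHom =
      (pt R (ρ (∏ i ∈ I, χ i))).toRingHom := by
  rw [map_prod, ← ptPow_comp_mHom]
  rfl

/-- The trivialization of `x^* m_I^* L`, `x = (χ_1, …, χ_n)`, given by a frame along `P`. -/
def sumTriv {ρ : P →* (G →* T)} (e : FrameAlong ρ L) (χ : Fin n → P) (I : Finset (Fin n)) :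
    pullback (ptPow R (fun i => ρ (χ i))).toRingHom (pullback (mHom R G n I).toRingHom L) ≃ₗ[T] T :=
  (pullbackComp (mHom R G n I).toRingHom (ptPow R (fun i => ρ (χ i))).toRingHom L).trans
    (castTriv (ptPow_comp_mHom_toRingHom ρ χ I) (e (∏ i ∈ I, χ i)))

theorem coordPos_sumTriv {ρ : P →* (G →* T)} (e : FrameAlong ρ L) (χ : Fin n → P)
    (I : Finset (Fin n)) (l : L) :
    coordPos _ (sumTriv e χ I) (pullbackSection (mHom R G n I).toRingHom L l) =
      coordPos _ (e (∏ i ∈ I, χ i)) l := by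
  rw [sumTriv, coordPos_pullbackComp, coordPos_castTriv]

/-- The analogue of `thetaCoord` for a frame along a monoid of points. -/
def thetaCoordAlong {ρ : P →* (G →* T)} (e : FrameAlong ρ L) (χ : Fin n → P) :
    Theta n L →ₛₗ[(ptPow R (fun i => ρ (χ i))).toRingHom] T :=
  coordTensor _ (fun I : Finset (Fin n) => coordPow _ (sumTriv e χ I) _)

theorem span_range_thetaCoordAlong [Module.Invertible (MonoidAlgebra R G) L]
    {ρ : P →* (G →* T)} (e : FrameAlong ρ L) (χ : Fin n → P) :
    Ideal.span (Set.range (thetaCoordAlong e χ)) = ⊤ :=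
  span_range_coordTensor fun _ => span_range_coordPow _ _

/-- The alternating product `∏_I u(∑_{i ∈ I} χ_i)^{(-1)^{n - #I}}`. -/
def unitCube (u : P → Tˣ) (χ : Fin n → P) : Tˣ :=
  (tupleCube (fun p => Additive.ofMul (u p)) χ).toMul

/-- The frame `e'` is obtained from `e` by extension of scalars along `g`, by the change `π` of the
monoid of points, and by multiplication with the units `u`. -/
def FrameRel {ρ : P →* (G →* T)} {ρ' : P' →* (G →* T')} (g : T →ₐ[R] T') (π : P →* P')
    (u : P → T'ˣ) (e : FrameAlong ρ L) (e' : FrameAlong ρ' L) : Prop :=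
  ∀ p l, coordPos _ (e' (π p)) l = u p * g (coordPos _ (e p) l)

theorem pt_comp_eq (g : T →ₐ[R] T') {ρ : G →* T} {ρ' : G →* T'} (h : ∀ a, ρ' a = g (ρ a)) :
    pt R ρ' = g.comp (pt R ρ) := by
  refine MonoidAlgebra.algHom_ext (fun a => ?_) (Subsingleton.elim _ _)
  change pt R ρ' (MonoidAlgebra.of R G a) = g (pt R ρ (MonoidAlgebra.of R G a))
  rw [pt_of, pt_of, h]

theorem ptPow_comp_eq (g : T →ₐ[R] T') {ρ : Fin n → (G →* T)} {ρ' : Fin n → (G →* T')}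
    (h : ∀ i a, ρ' i a = g (ρ i a)) : ptPow R ρ' = g.comp (ptPow R ρ) := by
  refine MonoidAlgebra.algHom_ext (fun a => ?_) (Subsingleton.elim _ _)
  change ptPow R ρ' (MonoidAlgebra.of R _ a) = g (ptPow R ρ (MonoidAlgebra.of R _ a))
  rw [ptPow_of, ptPow_of, map_prod]
  exact Finset.prod_congr rfl fun i _ => h i _

/-- Change of frames, extension of scalars and change of the monoid of points for the coordinates
on `Θ_n(L)`. -/
theorem FrameRel.thetaCoordAlong_eq {ρ : P →* (G →* T)} {ρ' : P' →* (G →* T')} {g : T →ₐ[R] T'}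
    {π : P →* P'} (hρ : ∀ p a, ρ' (π p) a = g (ρ p a)) {u : P → T'ˣ} {e : FrameAlong ρ L}
    {e' : FrameAlong ρ' L} (h : FrameRel g π u e e') (χ : Fin n → P) (θ : Theta n L) :
    thetaCoordAlong e' (fun i => π (χ i)) θ = unitCube u χ * g (thetaCoordAlong e χ θ) := by
  have hpt : (ptPow R (fun i => ρ' (π (χ i)))).toRingHom =
      (g : T →+* T').comp (ptPow R (fun i => ρ (χ i))).toRingHom := by
    rw [ptPow_comp_eq g fun i a => hρ (χ i) a]
    rfl
  refine (coordTensor_eq_of_forall (g : T →+* T') hpt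
    (φ := fun I => coordPow _ (sumTriv e χ I) _)
    (fun I => (((u (∏ i ∈ I, χ i)) ^ ((-1 : ℤ) ^ (n - I.card)) : T'ˣ) : T'))
    (fun I w => ?_) θ).trans ?_
  · refine coordPow_eq_of_forall (g : T →+* T') hpt (u (∏ i ∈ I, χ i)) (fun z => ?_) _ w
    refine coordPos_eq_of_forall_pullbackSection _ (g : T →+* T') hpt _ (fun l => ?_) z
    rw [coordPos_sumTriv, coordPos_sumTriv]
    have := h (∏ i ∈ I, χ i) l
    have h2 : ∏ i ∈ I, π (χ i) = π (∏ i ∈ I, χ i) := (map_prod π _ _).symm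
    rw [← h2] at this
    exact this
  · rw [unitCube, tupleCube_eq_sum]
    simp only [← ofMul_zpow, ← ofMul_prod, toMul_ofMul, Units.coe_prod]
    rfl

/-- The section `Δ_n^* θ ⊗ w` of `L^♭`. -/
def flatSection (θ : Theta n L) (w : tpow L (-(n.factorial : ℤ))) : flat n L :=
  (pullbackSection (diagHom R G n).toRingHom (Theta n L) θ ⊗ₜ[MonoidAlgebra R G] w :
    delta n L ⊗[MonoidAlgebra R G] tpow L (-(n.factorial : ℤ)))

/-- The frame `E` of `L^♭` along `P` is induced by the frame `e` of `L`. -/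
def IsInducedAlong {ρ : P →* (G →* T)} (e : FrameAlong ρ L) (E : FrameAlong ρ (flat n L)) : Prop :=
  ∀ (p : P) (θ : Theta n L) (w : tpow L (-(n.factorial : ℤ))),
    coordPos _ (E p) (flatSection θ w) =
      thetaCoordAlong e (fun _ => p) θ * coordPow _ (e p) _ w

instance [Module.Invertible (MonoidAlgebra R G) L] :
    Module.Invertible (CoordRing R G n) (Theta n L) :=
  inferInstanceAs (Module.Invertible (CoordRing R G n) (⨂[CoordRing R G n] I : Finset (Fin n),
    tpow (pullback (mHom R G n I).toRingHom L) ((-1) ^ (n - I.card))))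

instance [Module.Invertible (MonoidAlgebra R G) L] :
    Module.Invertible (MonoidAlgebra R G) (delta n L) :=
  inferInstanceAs (Module.Invertible _ (pullback (diagHom R G n).toRingHom (Theta n L)))

instance [Module.Invertible (MonoidAlgebra R G) L] :
    Module.Invertible (MonoidAlgebra R G) (flat n L) :=
  inferInstanceAs (Module.Invertible _
    (delta n L ⊗[MonoidAlgebra R G] tpow L (-(n.factorial : ℤ))))

/-- The induced coordinate on `L^♭` comes from a trivialization, because its values generate the unit
ideal. -/
theorem exists_isInducedAlong [Module.Invertible (MonoidAlgebra R G) L] (n : ℕ)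
    {ρ : P →* (G →* T)} (e : FrameAlong ρ L) :
    ∃ E : FrameAlong ρ (flat n L), IsInducedAlong e E := by
  have key : ∀ p, ∃ E : pullback (pt R (ρ p)).toRingHom (flat n L) ≃ₗ[T] T,
      ∀ (θ : Theta n L) (w : tpow L (-(n.factorial : ℤ))),
        coordPos _ E (flatSection θ w) =
        thetaCoordAlong e (fun _ => p) θ * coordPow _ (e p) _ w := fun p => by
    obtain ⟨t, ht⟩ := exists_coordPos_eq _ (Theta n L) (thetaCoordAlong e (fun _ : Fin n => p))
      (span_range_thetaCoordAlong e _)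
    have hd : (pt R (ρ p)).toRingHom.comp (diagHom R G n).toRingHom =
        (ptPow R (fun _ : Fin n => ρ p)).toRingHom := by
      rw [← pt_comp_diagHom]
      rfl
    let d : pullback (pt R (ρ p)).toRingHom (delta n L) ≃ₗ[T] T :=
      (pullbackComp (diagHom R G n).toRingHom (pt R (ρ p)).toRingHom (Theta n L)).trans
        (castTriv hd t)
    obtain ⟨ω, hω, hs⟩ := exists_coord_tmul (coordPos _ d)
      (coordPow _ (e p) (-(n.factorial : ℤ))) (span_range_coordPos d) (span_range_coordPow _ _)
    obtain ⟨E, hE⟩ := exists_coordPos_eq _ (flat n L) ω hs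
    refine ⟨E, fun θ w => (hE _).trans ((hω _ _).trans ?_)⟩
    have hd' : coordPos _ d (pullbackSection (diagHom R G n).toRingHom (Theta n L) θ) =
        thetaCoordAlong e (fun _ => p) θ :=
      (coordPos_pullbackComp _ _ _ θ).trans ((coordPos_castTriv hd t θ).trans (ht θ))
    exact congrArg (· * _) hd'
  choose E hE using key
  exact ⟨E, hE⟩

/-- The change of the induced frames of `L^♭` under a change of frames of `L`. -/
def flatUnit (n : ℕ) (u : P → Tˣ) : P → Tˣ := fun p =>
  (flatFun n (fun p => Additive.ofMul (u p)) p).toMul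

theorem flat_induction {motive : flat n L → Prop}
    (add : ∀ z w, motive z → motive w → motive (z + w)) (zero : motive 0)
    (tmul : ∀ (a : MonoidAlgebra R G) (θ : Theta n L) (w : tpow L (-(n.factorial : ℤ))),
      motive (a • flatSection θ w)) (z : flat n L) :
    motive z := by
  have key : ∀ z : delta n L ⊗[MonoidAlgebra R G] tpow L (-(n.factorial : ℤ)), motive z :=
    fun z => by
      induction z using TensorProduct.induction_on with
      | zero => exact zero
      | add z w hz hw => exact add z w hz hw
      | tmul d w =>
        have : ∀ d : pullback (diagHom R G n).toRingHom (Theta n L), motive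
            ((d : delta n L) ⊗ₜ[MonoidAlgebra R G] w :
              delta n L ⊗[MonoidAlgebra R G] tpow L (-(n.factorial : ℤ))) := fun d => by
          induction d using pullback_induction with
          | zero => exact (TensorProduct.zero_tmul (R := MonoidAlgebra R G) (delta n L) w).symm ▸ zero
          | add d d' hd hd' =>
            exact (TensorProduct.add_tmul (R := MonoidAlgebra R G) (d : delta n L) d' w).symm ▸
              add _ _ hd hd'
          | smul a θ => exact tmul a θ w
        exact this d
  exact key z

/-- Change of frames, extension of scalars and change of the monoid of points for the induced frames
of `L^♭`. -/
theorem FrameRel.flat {ρ : P →* (G →* T)} {ρ' : P' →* (G →* T')} {g : T →ₐ[R] T'}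
    {π : P →* P'} (hρ : ∀ p a, ρ' (π p) a = g (ρ p a)) {u : P → T'ˣ} {e : FrameAlong ρ L}
    {e' : FrameAlong ρ' L} (h : FrameRel g π u e e') {E : FrameAlong ρ (flat n L)}
    {E' : FrameAlong ρ' (flat n L)} (hE : IsInducedAlong e E) (hE' : IsInducedAlong e' E') :
    FrameRel g π (flatUnit n u) E E' := by
  intro p z
  have hpt : (pt R (ρ' (π p))) = g.comp (pt R (ρ p)) := pt_comp_eq g (hρ p)
  have hpt' : (pt R (ρ' (π p))).toRingHom = (g : T →+* T').comp (pt R (ρ p)).toRingHom := by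
    rw [hpt]; rfl
  induction z using flat_induction with
  | zero => rw [map_zero, map_zero, map_zero, mul_zero]
  | add z w hz hw => rw [map_add, map_add, map_add, hz, hw, mul_add]
  | tmul a θ w =>
    rw [LinearMap.map_smulₛₗ, LinearMap.map_smulₛₗ, smul_eq_mul, smul_eq_mul, map_mul]
    have e1 := hE p θ w
    have e2 := hE' (π p) θ w
    have e3 := h.thetaCoordAlong_eq hρ (fun _ : Fin n => p) θ
    have e4 := coordPow_eq_of_forall (g : T →+* T') hpt' (u p) (h p) _ w
    have e5 : (pt R (ρ' (π p))).toRingHom a = g ((pt R (ρ p)).toRingHom a) :=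
      RingHom.congr_fun hpt' a
    have e6 : flatUnit n u p = unitCube u (fun _ : Fin n => p) * u p ^ (-(n.factorial : ℤ)) := by
      rw [zpow_neg, zpow_natCast, ← div_eq_mul_inv]
      rfl
    refine (congrArg₂ (· * ·) e5 (e2.trans (congrArg₂ (· * ·) e3 e4))).trans ?_
    refine Eq.trans ?_ (congrArg (fun t => (flatUnit n u p : T') *
      (g ((pt R (ρ p)).toRingHom a) * g t)) e1.symm)
    rw [e6, map_mul, Units.val_mul]
    change _ * (_ * _ * (_ * g _)) = _
    ring

end Frames

/-! ### Faithfully flat descent of trivializations -/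

section Descent

variable {A : Type u} [CommRing A]

theorem faithfullyFlat_pi_localization (F : Finset A) (hF : Ideal.span (F : Set A) = ⊤) :
    Module.FaithfullyFlat A (∀ b : F, Localization.Away (b : A)) := by
  have hflat : Module.Flat A (∀ b : F, Localization.Away (b : A)) := by
    have : ∀ b : F, Module.Flat A (Localization.Away (b : A)) := fun b =>
      IsLocalization.flat _ (Submonoid.powers (b : A))
    classical
    exact Module.Flat.of_linearEquiv
      (DirectSum.linearEquivFunOnFintype A F fun b => Localization.Away (b : A)).symm
  refine ⟨fun m hm h => ?_⟩
  have h1 : Ideal.map (algebraMap A (∀ b : F, Localization.Away (b : A))) m = ⊤ := by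
    rw [Ideal.smul_top_eq_map] at h
    exact (Submodule.restrictScalars_eq_top_iff _ _ _).mp h
  have h2 : ∀ b ∈ F, b ∈ m := fun b hb => by
    have h3 := congrArg (Ideal.map (Pi.evalRingHom (fun b : F => Localization.Away (b : A)) ⟨b, hb⟩))
      h1
    rw [Ideal.map_map, Ideal.map_top] at h3
    by_contra hbm
    exact (IsLocalization.map_algebraMap_ne_top_iff_disjoint (Submonoid.powers b)
      (Localization.Away b) m).mpr
      ((Ideal.disjoint_powers_iff_notMem b hm.isPrime.isRadical).mpr hbm) h3
  exact hm.ne_top (top_le_iff.mp (hF ▸ Ideal.span_le.mpr h2))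

/-- Finitely many invertible modules become trivial over a common faithfully flat algebra, which is
a product of localizations. -/
theorem exists_faithfullyFlat_trivializing {J : Type*} [Finite J] (M : J → ModuleCat.{u} A)
    [∀ j, Module.Invertible A (M j)] :
    ∃ (T : Type u) (_ : CommRing T) (_ : Algebra A T), Module.FaithfullyFlat A T ∧
      ∀ j, ∃ φ : M j →ₛₗ[algebraMap A T] T, Ideal.span (Set.range φ) = ⊤ := by
  let S : Set A := {b | ∀ j, ∃ (ψ : Module.Dual A (M j)) (m : M j), ψ m ∣ b}
  have hS : Ideal.span S = ⊤ := by
    by_contra hne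
    obtain ⟨p, hp, hSp⟩ := Ideal.exists_le_maximal _ hne
    have h1 : ∀ j, ∃ (ψ : Module.Dual A (M j)) (m : M j), ψ m ∉ p := fun j => by
      by_contra hall
      push Not at hall
      have hle : ∀ z, Module.Invertible.linearEquiv A (M j) z ∈ p := fun z => by
        induction z using TensorProduct.induction_on with
        | zero => simp
        | tmul ψ m => exact hall ψ m
        | add z w hz hw => rw [map_add]; exact add_mem hz hw
      refine hp.ne_top ((Ideal.eq_top_iff_one p).mpr ?_)
      rw [← (Module.Invertible.linearEquiv A (M j)).apply_symm_apply 1]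
      exact hle _
    choose ψ m hψ using h1
    have := Fintype.ofFinite J
    have hb : ∏ j, ψ j (m j) ∈ S := fun j =>
      ⟨ψ j, m j, Finset.dvd_prod_of_mem _ (Finset.mem_univ j)⟩
    obtain ⟨j, -, hj⟩ := (hp.isPrime.prod_mem_iff).mp (hSp (Ideal.subset_span hb))
    exact hψ j hj
  obtain ⟨F, hFS, hF⟩ := (Ideal.span_eq_top_iff_finite S).mp hS
  refine ⟨∀ b : F, Localization.Away (b : A), inferInstance, inferInstance,
    faithfullyFlat_pi_localization F hF, fun j => ?_⟩
  choose ψ m hψ using fun b : F => hFS b.2 j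
  let φ : M j →ₛₗ[algebraMap A (∀ b : F, Localization.Away (b : A))]
      (∀ b : F, Localization.Away (b : A)) :=
    { toFun := fun z b => algebraMap A _ (ψ b z)
      map_add' := fun z w => by funext b; simp
      map_smul' := fun a z => by funext b; simp }
  refine ⟨φ, ?_⟩
  classical
  have hu : ∀ b : F, IsUnit (algebraMap A (Localization.Away (b : A)) (ψ b (m b))) := fun b =>
    isUnit_of_dvd_unit (map_dvd _ (hψ b)) (IsLocalization.Away.algebraMap_isUnit (b : A))
  rw [Ideal.eq_top_iff_one]
  have h1 : (1 : ∀ b : F, Localization.Away (b : A)) =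
      ∑ b : F, Pi.single b ((hu b).unit⁻¹ : (Localization.Away (b : A))ˣ).val * φ (m b) := by
    funext b
    rw [Finset.sum_apply, Finset.sum_eq_single b]
    · rw [Pi.mul_apply, Pi.single_eq_same]
      exact ((hu b).val_inv_mul).symm
    · intro c _ hc
      rw [Pi.mul_apply, Pi.single_eq_of_ne hc.symm, zero_mul]
    · simp
  rw [h1]
  exact sum_mem fun b _ => Ideal.mul_mem_left _ _ (Ideal.subset_span ⟨m b, rfl⟩)

/-- If a coordinate on an invertible module `N` over a faithfully flat algebra `T` takes values in
the equalizer of `T ⇉ T ⊗ T`, then it comes from a trivialization of `N`. -/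
theorem exists_trivialization_of_descent {T : Type u} [CommRing T] [Algebra A T]
    [Module.FaithfullyFlat A T] {f : A →+* T} (hf : f = algebraMap A T) (N : ModuleCat.{u} A)
    [Module.Invertible A N] (φ : N →ₛₗ[f] T) (hφ : Ideal.span (Set.range φ) = ⊤)
    (h : ∀ m, (φ m ⊗ₜ[A] (1 : T) : T ⊗[A] T) = (1 : T) ⊗ₜ[A] φ m) :
    ∃ η : A ≃ₗ[A] N, φ (η 1) = 1 := by
  subst hf
  have hinj : Function.Injective (algebraMap A T) := FaithfulSMul.algebraMap_injective A T
  have hex : ∀ m, ∃ a, algebraMap A T a = φ m := fun m => by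
    have h1 := (Algebra.IsEffective.of_faithfullyFlat A T).eqLocus_includeLeft_includeRight
    have h2 : φ m ∈ Set.range (algebraMap A T) := by
      rw [← h1]
      exact h m
    exact h2
  choose l hl using hex
  let F : N →ₗ[A] A :=
    { toFun := l
      map_add' := fun m m' => hinj (by rw [map_add, hl, hl, hl, map_add])
      map_smul' := fun a m => hinj (by
        rw [hl, LinearMap.map_smulₛₗ, RingHom.id_apply, smul_eq_mul, smul_eq_mul, map_mul, hl]) }
  have hs : Function.Surjective F := by
    rw [← LinearMap.range_eq_top]
    by_contra hne
    obtain ⟨p, hp, hle⟩ := Ideal.exists_le_maximal (LinearMap.range F) hne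
    refine Module.FaithfullyFlat.submodule_ne_top (M := T) hp ?_
    rw [Ideal.smul_top_eq_map, Submodule.restrictScalars_eq_top_iff, ← top_le_iff, ← hφ]
    refine Ideal.span_le.mpr ?_
    rintro _ ⟨m, rfl⟩
    rw [← hl]
    exact Ideal.mem_map_of_mem _ (hle ⟨m, rfl⟩)
  let E : N ≃ₗ[A] A := LinearEquiv.ofBijective F (Module.Invertible.bijective_of_surjective hs)
  refine ⟨E.symm, ?_⟩
  rw [← hl, ← map_one (algebraMap A T)]
  exact congrArg _ (E.apply_symm_apply 1)

end Descent

/-! ### Coordinates of hypercubic structures -/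

section Logs

variable {R : Type u} [CommRing R] {G : Type u} [CommGroup G]
variable {T T' : Type u} [CommRing T] [Algebra R T] [CommRing T'] [Algebra R T']
variable {P P' : Type*} [CommMonoid P] [CommMonoid P'] {n : ℕ}
variable {L : ModuleCat.{u} (MonoidAlgebra R G)}

theorem isUnit_coord_generator {A : Type u} [CommRing A] {N : ModuleCat.{u} A} (ξ : A ≃ₗ[A] N)
    {f : A →+* T} (φ : N →ₛₗ[f] T) (hφ : Ideal.span (Set.range φ) = ⊤) : IsUnit (φ (ξ 1)) := by
  rw [← Ideal.span_singleton_eq_top, eq_top_iff, ← hφ]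
  refine Ideal.span_le.mpr ?_
  rintro _ ⟨m, rfl⟩
  have : m = ξ.symm m • ξ 1 := by rw [← map_smul, smul_eq_mul, mul_one, ξ.apply_symm_apply]
  rw [this, LinearMap.map_smulₛₗ]
  exact Ideal.mul_mem_left _ _ (Ideal.mem_span_singleton_self _)

theorem thetaCoord_ptPow (e : Frame L T) (χ : Fin n → (G →* T)) (θ : Theta n L) :
    thetaCoord e (ptPow R χ) θ =
      thetaCoordAlong (ρ := MonoidHom.id _) (fun χ => e (pt R χ)) χ θ := by
  have key : ∀ {x y : MonoidAlgebra R G →ₐ[R] T} (h : x = y) (h' : x.toRingHom = y.toRingHom),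
      castTriv h' (e y) = e x := by
    rintro x _ rfl _
    rfl
  have : ∀ I : Finset (Fin n), castTriv (ptPow_comp_mHom_toRingHom (MonoidHom.id _) χ I)
      (e (pt R (∏ i ∈ I, χ i))) = e ((ptPow R χ).comp (mHom R G n I)) := fun I =>
    key (ptPow_comp_mHom χ I) _
  simp only [thetaCoord, thetaCoordAlong, sumTriv]
  congr 2
  funext I
  congr 2
  exact (this I).symm

variable [Module.Invertible (MonoidAlgebra R G) L]

/-- The coordinate of `ξ(1)` with respect to a frame along `P`, as an element of the group of
units of `T`, written additively. -/
def logCoord (ξ : Triv n L) {ρ : P →* (G →* T)} (e : FrameAlong ρ L) (χ : Fin n → P) :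
    Additive Tˣ :=
  Additive.ofMul (isUnit_coord_generator ξ _ (span_range_thetaCoordAlong e χ)).unit

theorem coe_logCoord (ξ : Triv n L) {ρ : P →* (G →* T)} (e : FrameAlong ρ L) (χ : Fin n → P) :
    ((logCoord ξ e χ).toMul : T) = thetaCoordAlong e χ (ξ 1) := rfl

/-- The homomorphism between groups of units, written additively. -/
def unitsMap (g : T →ₐ[R] T') : Additive Tˣ →+ Additive T'ˣ :=
  (Units.map (g : T →* T')).toAdditive

theorem FrameRel.logCoord_eq {ρ : P →* (G →* T)} {ρ' : P' →* (G →* T')} {g : T →ₐ[R] T'}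
    {π : P →* P'} (hρ : ∀ p a, ρ' (π p) a = g (ρ p a)) {u : P → T'ˣ} {e : FrameAlong ρ L}
    {e' : FrameAlong ρ' L} (h : FrameRel g π u e e') (ξ : Triv n L) (χ : Fin n → P) :
    logCoord ξ e' (π ∘ χ) =
      unitsMap g (logCoord ξ e χ) + tupleCube (fun p => Additive.ofMul (u p)) χ := by
  refine Additive.toMul.injective (Units.ext ?_)
  rw [add_comm]
  exact h.thetaCoordAlong_eq hρ χ (ξ 1)

/-- Extension of scalars of a trivialization along `g : T → T'`. -/
theorem exists_triv_map {A : Type u} [CommRing A] {M : ModuleCat.{u} A} [Module.Invertible A M]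
    {f : A →+* T} {f' : A →+* T'} (g : T →+* T') (hf : f' = g.comp f) (e : pullback f M ≃ₗ[T] T) :
    ∃ e' : pullback f' M ≃ₗ[T'] T', ∀ m, coordPos f' e' m = g (coordPos f e m) := by
  subst hf
  let φ : M →ₛₗ[g.comp f] T' :=
    { toFun := fun m => g (coordPos f e m)
      map_add' := fun m m' => by rw [map_add, map_add]
      map_smul' := fun a m => by
        rw [LinearMap.map_smulₛₗ, smul_eq_mul, map_mul]
        rfl }
  have hφ : Ideal.span (Set.range φ) = ⊤ := by
    have h1 := congrArg (Ideal.map g) (span_range_coordPos e)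
    rw [Ideal.map_span, Ideal.map_top, ← Set.range_comp] at h1
    exact h1
  exact exists_coordPos_eq _ M φ hφ

theorem pt_toRingHom_eq (g : T →ₐ[R] T') {χ : G →* T} {χ' : G →* T'} (h : ∀ a, χ' a = g (χ a)) :
    (pt R χ').toRingHom = (g : T →+* T').comp (pt R χ).toRingHom := by
  rw [pt_comp_eq g h]
  rfl

/-- Any two frames of `L` along compatible monoids of points are related by units. -/
theorem exists_frameRel {ρ : P →* (G →* T)} {ρ' : P' →* (G →* T')} {g : T →ₐ[R] T'}
    {π : P →* P'} (hρ : ∀ p a, ρ' (π p) a = g (ρ p a)) (e : FrameAlong ρ L)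
    (e' : FrameAlong ρ' L) : ∃ u : P → T'ˣ, FrameRel g π u e e' := by
  have key : ∀ p, ∃ u : T'ˣ, ∀ l, coordPos _ (e' (π p)) l = u * g (coordPos _ (e p) l) := fun p => by
    obtain ⟨e₁, he₁⟩ := exists_triv_map (g : T →+* T') (pt_toRingHom_eq g (hρ p)) (e p)
    obtain ⟨u, hu⟩ := exists_unit_coordPos e₁ (e' (π p))
    exact ⟨u, fun l => by rw [hu, he₁]; rfl⟩
  choose u hu using key
  exact ⟨u, hu⟩

/-- The coordinate of a section of `Θ_n(L^♭)`, divided by the coordinate that is prescribed for the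
generator `ξ^♭(1)`. -/
def normCoord (ξ : Triv (n + 1) L) {ρ : P →* (G →* T)} (e : FrameAlong ρ L)
    (E : FrameAlong ρ (flat n L)) (χ : Fin n → P) (m : Theta n (flat n L)) : T :=
  ↑((flatLog (logCoord ξ e) χ).toMul⁻¹) * thetaCoordAlong E χ m

/-- The normalized coordinate does not depend on the frames: under a change of frames of `L` by `u`,
both the coordinate of a section of `Θ_n(L^♭)` and the one prescribed for `ξ^♭(1)` are multiplied by
`θ_n(u^♭)`. -/
theorem FrameRel.normCoord_eq {ρ : P →* (G →* T)} {ρ' : P' →* (G →* T')} {g : T →ₐ[R] T'}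
    {π : P →* P'} (hρ : ∀ p a, ρ' (π p) a = g (ρ p a)) {u : P → T'ˣ} {e : FrameAlong ρ L}
    {e' : FrameAlong ρ' L} (h : FrameRel g π u e e') {E : FrameAlong ρ (Hypercubic.flat n L)}
    {E' : FrameAlong ρ' (Hypercubic.flat n L)} (hE : IsInducedAlong e E)
    (hE' : IsInducedAlong e' E') (ξ : Triv (n + 1) L) (χ : Fin n → P)
    (m : Theta n (Hypercubic.flat n L)) :
    normCoord ξ e' E' (π ∘ χ) m = g (normCoord ξ e E χ m) := by
  have h1 : flatLog (logCoord ξ e') (π ∘ χ) = unitsMap g (flatLog (logCoord ξ e) χ) +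
      tupleCube (flatFun n fun p => Additive.ofMul (u p)) χ := by
    rw [← flatLog_comp, ← flatLog_map, ← flatLog_tupleCube, ← flatLog_add]
    congr 1
    funext χ'
    exact h.logCoord_eq hρ ξ χ'
  have h2 := (h.flat hρ hE hE').thetaCoordAlong_eq hρ χ m
  have h3 : unitCube (flatUnit n u) χ =
      (tupleCube (flatFun n fun p => Additive.ofMul (u p)) χ).toMul := rfl
  have h4 : thetaCoordAlong E' (π ∘ χ) m = thetaCoordAlong E' (fun i => π (χ i)) m := rfl
  have h5 : g ↑((flatLog (logCoord ξ e) χ).toMul⁻¹) =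
      ↑((unitsMap g (flatLog (logCoord ξ e) χ)).toMul⁻¹) :=
    congrArg Units.val (map_inv (Units.map (g : T →* T')) (flatLog (logCoord ξ e) χ).toMul)
  rw [normCoord, normCoord, h1, h4, h2, map_mul, h5, toMul_add, ← h3, mul_inv, ← mul_assoc]
  change ↑((unitsMap g (flatLog (logCoord ξ e) χ)).toMul⁻¹ * (unitCube (flatUnit n u) χ)⁻¹) *
    (unitCube (flatUnit n u) χ : T') * _ = _
  rw [← Units.val_mul, inv_mul_cancel_right]

/-- Normalized coordinates with respect to frames over `T` and over `T'` agree over every common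
algebra over which the two families of points agree. -/
theorem normCoord_eq_normCoord {X : Type u} [CommRing X] [Algebra R X] {ρ : P →* (G →* T)}
    {ρ' : P →* (G →* T')} {g : T →ₐ[R] X} {g' : T' →ₐ[R] X} (hg : ∀ p a, g (ρ p a) = g' (ρ' p a))
    {e : FrameAlong ρ L} {e' : FrameAlong ρ' L} {E : FrameAlong ρ (flat n L)}
    {E' : FrameAlong ρ' (flat n L)} (hE : IsInducedAlong e E) (hE' : IsInducedAlong e' E')
    (ξ : Triv (n + 1) L) (χ : Fin n → P) (m : Theta n (flat n L)) :
    g (normCoord ξ e E χ m) = g' (normCoord ξ e' E' χ m) := by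
  let ρX : P →* (G →* X) := (MonoidHom.compHom (g : T →* X)).comp ρ
  have hρ : ∀ p a, ρX (MonoidHom.id P p) a = g (ρ p a) := fun p a => rfl
  have hρ' : ∀ p a, ρX (MonoidHom.id P p) a = g' (ρ' p a) := hg
  choose eX heX using fun p =>
    exists_triv_map (g : T →+* X) (pt_toRingHom_eq g (hρ p)) (e p)
  let eX' : FrameAlong ρX L := eX
  obtain ⟨EX, hEX⟩ := exists_isInducedAlong n eX'
  obtain ⟨u, hu⟩ := exists_frameRel hρ e eX'
  obtain ⟨u', hu'⟩ := exists_frameRel hρ' e' eX'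
  rw [← hu.normCoord_eq hρ hE hEX, ← hu'.normCoord_eq hρ' hE' hEX]

end Logs

/-! ### Frames at all points, and the characterization of `ξ^♭` -/

section Full

variable {R : Type u} [CommRing R] {G : Type u} [CommGroup G]
variable {T : Type u} [CommRing T] [Algebra R T] {n : ℕ}
variable {L : ModuleCat.{u} (MonoidAlgebra R G)}

/-- A frame at all points as a frame along the group of all points. -/
def Frame.along (e : Frame L T) : FrameAlong (MonoidHom.id (G →* T)) L := fun χ => e (pt R χ)

/-- A frame along the group of all points as a frame at all points. -/
def FrameAlong.toFrame (E : FrameAlong (MonoidHom.id (G →* T)) L) : Frame L T := fun x =>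
  castTriv (congrArg AlgHom.toRingHom ((MonoidAlgebra.lift R T G).apply_symm_apply x).symm)
    (E ((MonoidAlgebra.lift R T G).symm x))

theorem FrameAlong.coordPos_toFrame (E : FrameAlong (MonoidHom.id (G →* T)) L) (χ : G →* T)
    (l : L) : coordPos (pt R χ).toRingHom (E.toFrame (pt R χ)) l =
      coordPos (pt R χ).toRingHom (E χ) l := by
  refine (coordPos_castTriv (f := (pt R ((MonoidAlgebra.lift R T G).symm (pt R χ))).toRingHom)
    (f' := (pt R χ).toRingHom) _ _ _).trans ?_
  have : (MonoidAlgebra.lift R T G).symm (pt R χ) = χ :=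
    (MonoidAlgebra.lift R T G).symm_apply_apply χ
  have key : ∀ {χ' : G →* T}, χ' = χ → coordPos (pt R χ').toRingHom (E χ') l =
      coordPos (pt R χ).toRingHom (E χ) l := by
    rintro _ rfl
    rfl
  exact key this

theorem thetaCoord_congr (e : Frame L T) {x y : CoordRing R G n →ₐ[R] T} (h : x = y)
    (θ : Theta n L) : thetaCoord e x θ = thetaCoord e y θ := by
  subst h
  rfl

theorem thetaCoord_comp_diagHom (e : Frame L T) (χ : G →* T) (θ : Theta n L) :
    thetaCoord e ((pt R χ).comp (diagHom R G n)) θ = thetaCoordAlong e.along (fun _ => χ) θ :=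
  (thetaCoord_congr e (pt_comp_diagHom χ) θ).trans (thetaCoord_ptPow e (fun _ => χ) θ)

theorem IsInducedFrame.along {e : Frame L T} {e' : Frame (flat n L) T}
    (h : IsInducedFrame e e') : IsInducedAlong e.along e'.along := fun χ θ w =>
  (h (pt R χ) θ w).trans (congrArg (· * _) (thetaCoord_comp_diagHom e χ θ))

theorem exists_isInducedFrame [Module.Invertible (MonoidAlgebra R G) L] (n : ℕ) (e : Frame L T) :
    ∃ e' : Frame (flat n L) T, IsInducedFrame e e' := by
  obtain ⟨E, hE⟩ := exists_isInducedAlong n e.along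
  refine ⟨E.toFrame, fun x θ w => ?_⟩
  obtain ⟨χ, rfl⟩ := exists_eq_pt x
  refine (E.coordPos_toFrame χ (flatSection θ w)).trans ((hE χ θ w).trans ?_)
  exact congrArg (· * _) (thetaCoord_comp_diagHom e χ θ).symm

theorem exists_frame_of_isLocalRing [Module.Invertible (MonoidAlgebra R G) L] [IsLocalRing T] :
    Nonempty (Frame L T) := by
  refine ⟨fun x => ?_⟩
  have h : CommRing.Pic.mk T (pullback x.toRingHom L) = 1 := Subsingleton.elim _ _
  exact (CommRing.Pic.mk_eq_one_iff.mp h).some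

theorem compCoord_coe {P : Type u} [CommMonoid P] (c : (Fin (n + 1) → P) → Additive Tˣ) (i : Fin n)
    (χ : Fin n → P) (l : List P) :
    compCoord (fun h => ((c h).toMul : T)) i χ l = ((compLog c i χ l).toMul : T) := by
  induction l with
  | nil => simp [compCoord, compLog]
  | cons x l ih =>
    cases l with
    | nil => simp [compCoord, compLog]
    | cons y l => rw [compCoord, compLog, ih, toMul_add, Units.val_mul]

theorem multCoord_coe {P : Type u} [CommMonoid P] (c : (Fin (n + 1) → P) → Additive Tˣ)
    (χ : Fin n → P) (S : Finset (Fin n)) :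
    multCoord (fun h => ((c h).toMul : T)) χ S = ((multLog c χ S).toMul : T) := by
  simp only [multCoord, multLog, compCoord_coe, toMul_sum, Units.coe_prod]

theorem flatLog_add_sum_odd {P Q : Type*} [CommMonoid P] [AddCommGroup Q]
    (c : (Fin (n + 1) → P) → Q) (χ : Fin n → P) :
    flatLog c χ + ∑ S : Finset (Fin n) with Odd (n - S.card), multLog c χ S =
      ∑ S : Finset (Fin n) with Even (n - S.card), multLog c χ S := by
  rw [flatLog, ← Finset.sum_filter_add_sum_filter_not Finset.univ
    (fun S : Finset (Fin n) => Even (n - S.card)), add_assoc]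
  have h1 : ∀ S ∈ Finset.univ.filter (fun S : Finset (Fin n) => Even (n - S.card)),
      ((-1 : ℤ) ^ (n - S.card)) • multLog c χ S = multLog c χ S := fun S hS => by
    rw [(Finset.mem_filter.mp hS).2.neg_one_pow, one_smul]
  have h2 : ∀ S ∈ Finset.univ.filter (fun S : Finset (Fin n) => Odd (n - S.card)),
      ((-1 : ℤ) ^ (n - S.card)) • multLog c χ S = -multLog c χ S := fun S hS => by
    rw [(Finset.mem_filter.mp hS).2.neg_one_pow, neg_one_smul]
  simp only [Nat.not_even_iff_odd]
  rw [Finset.sum_congr rfl h1, Finset.sum_congr rfl h2, Finset.sum_neg_distrib, neg_add_cancel,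
    add_zero]

variable [Module.Invertible (MonoidAlgebra R G) L]

theorem trivCoord_eq (ξ : Triv n L) (e : Frame L T) :
    trivCoord ξ e = fun χ => ((logCoord ξ e.along χ).toMul : T) := by
  funext χ
  exact thetaCoord_ptPow e χ (ξ 1)

theorem trivCoord_mul_eq_iff (ξ : Triv (n + 1) L) (η : Triv n (flat n L)) (e : Frame L T)
    (e' : Frame (flat n L) T) (χ : Fin n → (G →* T)) :
    trivCoord η e' χ *
          ∏ S : Finset (Fin n) with Odd (n - S.card), multCoord (trivCoord ξ e) χ S =
        ∏ S : Finset (Fin n) with Even (n - S.card), multCoord (trivCoord ξ e) χ S ↔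
      logCoord η e'.along χ = flatLog (logCoord ξ e.along) χ := by
  have h := flatLog_add_sum_odd (logCoord ξ e.along) χ
  simp only [trivCoord_eq, multCoord_coe, ← Units.coe_prod, ← toMul_sum]
  rw [← h, toMul_add, ← Units.val_mul, Units.val_inj, mul_left_inj]
  rfl

theorem normCoord_eq_one_iff (ξ : Triv (n + 1) L) (η : Triv n (flat n L)) {P : Type*}
    [CommMonoid P] {ρ : P →* (G →* T)} (e : FrameAlong ρ L) (E : FrameAlong ρ (flat n L))
    (χ : Fin n → P) :
    normCoord ξ e E χ (η 1) = 1 ↔ logCoord η E χ = flatLog (logCoord ξ e) χ := by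
  rw [normCoord, Units.inv_mul_eq_one]
  constructor
  · intro h
    exact (Additive.toMul.injective (Units.ext h)).symm
  · intro h
    rw [← coe_logCoord, h]

end Full

/-! ### Hypercubic structures can be recognized over local rings -/

section Local

variable {R : Type u} [CommRing R] {G : Type u} [CommGroup G] {n : ℕ}
variable {L : ModuleCat.{u} (MonoidAlgebra R G)} [Module.Invertible (MonoidAlgebra R G) L]

theorem IsCubic.isCubicFun {ξ : Triv n L} (h : IsCubic n L ξ) {T : Type u} [CommRing T]
    [Algebra R T] (e : Frame L T) : IsCubicFun (logCoord ξ e.along) where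
  rigid := Additive.toMul.injective (Units.ext (by
    have := h.rigid T e
    rw [trivCoord_eq] at this
    exact this))
  symm χ σ := Additive.toMul.injective (Units.ext (by
    have := h.symm T e χ σ
    rw [trivCoord_eq] at this
    exact this))
  cocycle χ := Additive.toMul.injective (Units.ext (by
    have := h.cocycle T e χ
    rw [trivCoord_eq] at this
    exact this))

theorem isCubic_of_isCubicFun {ξ : Triv n L} (h : ∀ (T : Type u) [CommRing T] [Algebra R T]
    (e : Frame L T), IsCubicFun (logCoord ξ e.along)) : IsCubic n L ξ where
  rigid T _ _ e := by
    rw [trivCoord_eq]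
    exact congrArg (fun a : Additive Tˣ => (a.toMul : T)) (h T e).rigid
  symm T _ _ e χ σ := by
    rw [trivCoord_eq]
    exact congrArg (fun a : Additive Tˣ => (a.toMul : T)) ((h T e).symm χ σ)
  cocycle T _ _ e χ := by
    rw [trivCoord_eq]
    exact congrArg (fun a : Additive Tˣ => (a.toMul : T)) ((h T e).cocycle χ)

theorem IsCubicFun.comp {P P' : Type u} {Q : Type*} [CommMonoid P] [CommMonoid P'] [AddCommGroup Q]
    {c : (Fin n → P') → Q} (h : IsCubicFun c) (π : P →* P') :
    IsCubicFun fun χ : Fin n → P => c (π ∘ χ) where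
  rigid := by
    rw [← h.rigid]
    congr 1
    funext i
    simp
  symm χ σ := h.symm (π ∘ χ) σ
  cocycle χ := by
    have hA : π ∘ mapA χ = mapA (π ∘ χ) := by funext i; simp [mapA, apply_ite π]
    have hB : π ∘ mapB χ = mapB (π ∘ χ) := by funext i; simp [mapB, apply_ite π]
    have hC : π ∘ mapC χ = mapC (π ∘ χ) := by funext i; simp [mapC, apply_ite π]
    have hD : π ∘ mapD χ = mapD (π ∘ χ) := by funext i; simp [mapD]
    rw [hA, hB, hC, hD]
    exact h.cocycle _

theorem isCubicFun_of_forall {P : Type u} {Q κ : Type*} {Q' : κ → Type*} [CommMonoid P]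
    [AddCommGroup Q] [∀ k, AddCommGroup (Q' k)] {c : (Fin n → P) → Q} (g : ∀ k, Q →+ Q' k)
    (hg : ∀ a b, (∀ k, g k a = g k b) → a = b) (h : ∀ k, IsCubicFun fun χ => g k (c χ)) :
    IsCubicFun c where
  rigid := hg _ _ fun k => by rw [(h k).rigid, map_zero]
  symm χ σ := hg _ _ fun k => (h k).symm χ σ
  cocycle χ := hg _ _ fun k => by rw [map_add, map_add]; exact (h k).cocycle χ

/-- The conditions of a hypercubic structure only have to be checked for points with values in local
rings, and for one frame over each of them. -/
theorem isCubic_of_isLocalRing (hn : 2 ≤ n) {ξ : Triv n L}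
    (h : ∀ (T : Type u) [CommRing T] [Algebra R T] [IsLocalRing T],
      ∃ e : Frame L T, IsCubicFun (logCoord ξ e.along)) : IsCubic n L ξ := by
  refine isCubic_of_isCubicFun fun T _ _ e => ?_
  let g : ∀ I : MaximalSpectrum T, T →ₐ[R] Localization.AtPrime I.asIdeal := fun I =>
    IsScalarTower.toAlgHom R T (Localization.AtPrime I.asIdeal)
  refine isCubicFun_of_forall (fun I => unitsMap (g I)) (fun a b hab => ?_) fun I => ?_
  · refine Additive.toMul.injective (Units.ext ?_)
    refine MaximalSpectrum.toPiLocalization_injective T (funext fun I => ?_)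
    exact congrArg (fun a : Additive (Localization.AtPrime I.asIdeal)ˣ => a.toMul.val) (hab I)
  · obtain ⟨e', he'⟩ := h (Localization.AtPrime I.asIdeal)
    let π : (G →* T) →* (G →* Localization.AtPrime I.asIdeal) :=
      MonoidHom.compHom (g I : T →* Localization.AtPrime I.asIdeal)
    have hρ : ∀ (p : G →* T) (a : G),
        MonoidHom.id (G →* Localization.AtPrime I.asIdeal) (π p) a =
          g I (MonoidHom.id (G →* T) p a) := fun p a => rfl
    obtain ⟨u, hu⟩ := exists_frameRel hρ e.along e'.along
    have h1 : (fun χ => unitsMap (g I) (logCoord ξ e.along χ)) =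
        (fun χ => logCoord ξ e'.along (π ∘ χ)) +
          tupleCube (-fun p => Additive.ofMul (u p)) := by
      funext χ
      rw [Pi.add_apply, hu.logCoord_eq hρ ξ χ, add_assoc]
      rw [tupleCube, tupleCube, ← cube_add, add_neg_cancel, cube_zero_fun, add_zero]
    rw [h1]
    exact (he'.comp π).add (isCubicFun_tupleCube hn _)

/-- Any `ξ^♭` is an `n`-cubic structure. -/
theorem IsFlatStructure.isCubic (hn : 2 ≤ n) {ξ : Triv (n + 1) L} (hξ : IsCubic (n + 1) L ξ)
    {η : Triv n (flat n L)} (hη : IsFlatStructure ξ η) : IsCubic n (flat n L) η := by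
  refine isCubic_of_isLocalRing hn fun T _ _ _ => ?_
  obtain ⟨e⟩ := exists_frame_of_isLocalRing (T := T) (L := L)
  obtain ⟨e', he'⟩ := exists_isInducedFrame n e
  refine ⟨e', ?_⟩
  have : logCoord η e'.along = flatLog (logCoord ξ e.along) := by
    funext χ
    exact (trivCoord_mul_eq_iff ξ η e e' χ).mp (hη T e e' he' χ)
  rw [this]
  exact (hξ.isCubicFun e).flatLog hn

end Local

/-! ### Existence and uniqueness of `ξ^♭` -/

section Existence

variable {R : Type u} [CommRing R] {G : Type u} [CommGroup G] {n : ℕ}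

theorem ptPow_univChar : ptPow R (univChar R G n) = AlgHom.id R (CoordRing R G n) := by
  refine MonoidAlgebra.algHom_ext (fun g => ?_) (Subsingleton.elim _ _)
  change ptPow R (univChar R G n) (MonoidAlgebra.of R (Fin n → G) g) = MonoidAlgebra.of R _ g
  rw [ptPow_of]
  change ∏ i, MonoidAlgebra.of R (Fin n → G) (Pi.mulSingle i (g i)) = _
  rw [← map_prod, Finset.univ_prod_mulSingle]

/-- The point of `H^n` with values in an algebra over the coordinate ring of `H^n` that is induced
by the universal point. -/
theorem ptPow_eq_toAlgHom {T : Type u} [CommRing T] [Algebra R T] [Algebra (CoordRing R G n) T]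
    [IsScalarTower R (CoordRing R G n) T] {χ : Fin n → (G →* T)}
    (h : ∀ i a, χ i a = algebraMap (CoordRing R G n) T (univChar R G n i a)) :
    ptPow R χ = IsScalarTower.toAlgHom R (CoordRing R G n) T := by
  rw [ptPow_comp_eq (IsScalarTower.toAlgHom R (CoordRing R G n) T) h, ptPow_univChar]
  rfl

variable {L : ModuleCat.{u} (MonoidAlgebra R G)} [Module.Invertible (MonoidAlgebra R G) L]

theorem IsFlatStructure.unique {ξ : Triv (n + 1) L} {η η' : Triv n (flat n L)}
    (h : IsFlatStructure ξ η) (h' : IsFlatStructure ξ η') : η' = η := by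
  set b : CoordRing R G n := η.symm (η' 1) with hb
  have hη : η' 1 = b • η 1 := by
    rw [← map_smul, smul_eq_mul, mul_one, hb, η.apply_symm_apply]
  -- at the universal point over the local rings of `H^n`, both generators have the same coordinate
  have hb1 : b = 1 := by
    refine MaximalSpectrum.toPiLocalization_injective _ (funext fun I => ?_)
    let T := Localization.AtPrime I.asIdeal
    let χ : Fin n → (G →* T) := fun i =>
      (algebraMap (CoordRing R G n) T : CoordRing R G n →* T).comp (univChar R G n i)
    obtain ⟨e⟩ := exists_frame_of_isLocalRing (T := T) (L := L)
    obtain ⟨e', he'⟩ := exists_isInducedFrame n e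
    have h1 := (trivCoord_mul_eq_iff ξ η e e' χ).mp (h T e e' he' χ)
    have h2 := (trivCoord_mul_eq_iff ξ η' e e' χ).mp (h' T e e' he' χ)
    have h3 : thetaCoordAlong e'.along χ (η' 1) = thetaCoordAlong e'.along χ (η 1) := by
      rw [← coe_logCoord, ← coe_logCoord, h1, h2]
    rw [hη, LinearMap.map_smulₛₗ, smul_eq_mul] at h3
    have h4 : IsUnit (thetaCoordAlong e'.along χ (η 1)) :=
      isUnit_coord_generator η _ (span_range_thetaCoordAlong _ _)
    have h5 := h4.mul_right_cancel (h3.trans (one_mul _).symm)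
    have h6 : ptPow R χ = IsScalarTower.toAlgHom R (CoordRing R G n) T :=
      ptPow_eq_toAlgHom fun i a => rfl
    have h7 : (ptPow R χ).toRingHom b = algebraMap (CoordRing R G n) T b := by
      rw [h6]
      rfl
    rw [map_one]
    exact h7.symm.trans h5
  refine LinearEquiv.ext fun a => ?_
  rw [← mul_one a, ← smul_eq_mul, map_smul, map_smul, hη, hb1, one_smul]

/-- Over a faithfully flat algebra that trivializes the pull-backs of `L` along the (finitely many)
points `H^n → H` given by homomorphisms `G → G^n`, the prescribed coordinate of `ξ^♭(1)` defines a
generator; it descends, since normalized coordinates do not depend on the frames. -/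
theorem exists_isFlatStructure [Finite G] (ξ : Triv (n + 1) L) :
    ∃ η : Triv n (flat n L), IsFlatStructure ξ η := by
  let B := CoordRing R G n
  let P := G →* (Fin n → G)
  let ρB : P →* (G →* B) := MonoidHom.compHom (MonoidAlgebra.of R (Fin n → G))
  let χ : Fin n → P := fun i => MonoidHom.mulSingle (fun _ => G) i
  have : Finite P := DFunLike.finite P
  obtain ⟨T, _, _, hT, hφ⟩ := exists_faithfullyFlat_trivializing
    (fun p : P => pullback (pt R (ρB p)).toRingHom L)
  let : Algebra R T := ((algebraMap B T).comp (algebraMap R B)).toAlgebra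
  have : IsScalarTower R B T := IsScalarTower.of_algebraMap_eq fun _ => rfl
  let ρT : P →* (G →* T) := (MonoidHom.compHom (algebraMap B T : B →* T)).comp ρB
  have hρT : ∀ p, (pt R (ρT p)).toRingHom =
      (algebraMap B T).comp (pt R (ρB p)).toRingHom := fun p =>
    pt_toRingHom_eq (IsScalarTower.toAlgHom R B T) fun a => rfl
  choose φ hφ using hφ
  choose t ht using fun p => exists_coordPos_eq (algebraMap B T) _ (φ p) (hφ p)
  let e : FrameAlong ρT L := fun p => castTriv (hρT p)
    ((pullbackComp (pt R (ρB p)).toRingHom (algebraMap B T) L).symm.trans (t p))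
  obtain ⟨E, hE⟩ := exists_isInducedAlong n e
  let ψ : Theta n (flat n L) →ₛₗ[(ptPow R (fun i => ρT (χ i))).toRingHom] T :=
    (↑((flatLog (logCoord ξ e) χ).toMul⁻¹) : T) • thetaCoordAlong E χ
  have hψ : Ideal.span (Set.range ψ) = ⊤ := by
    rw [eq_top_iff, ← span_range_thetaCoordAlong E χ]
    refine Ideal.span_le.mpr ?_
    rintro _ ⟨m, rfl⟩
    have : thetaCoordAlong E χ m = ((flatLog (logCoord ξ e) χ).toMul : T) * ψ m := by
      change _ = ((flatLog (logCoord ξ e) χ).toMul : T) *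
        ((↑((flatLog (logCoord ξ e) χ).toMul⁻¹) : T) * thetaCoordAlong E χ m)
      rw [Units.mul_inv_cancel_left]
    rw [this]
    exact Ideal.mul_mem_left _ _ (Ideal.subset_span ⟨m, rfl⟩)
  have hf : (ptPow R (fun i => ρT (χ i))).toRingHom = algebraMap B T := by
    rw [ptPow_eq_toAlgHom fun i a => rfl]
    rfl
  obtain ⟨η, hη⟩ := exists_trivialization_of_descent hf (Theta n (flat n L)) ψ hψ fun m =>
    normCoord_eq_normCoord
      (g := (Algebra.TensorProduct.includeLeft : T →ₐ[B] T ⊗[B] T).restrictScalars R)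
      (g' := (Algebra.TensorProduct.includeRight : T →ₐ[B] T ⊗[B] T).restrictScalars R)
      (fun p a => ((Algebra.TensorProduct.includeLeft : T →ₐ[B] T ⊗[B] T).commutes _).trans
        ((Algebra.TensorProduct.includeRight : T →ₐ[B] T ⊗[B] T).commutes _).symm) hE hE ξ χ m
  refine ⟨η, fun T' _ _ e' e'' he' χ' => ?_⟩
  rw [trivCoord_mul_eq_iff, ← normCoord_eq_one_iff]
  -- the points of `P` with values in `T'` that are induced by `χ'`
  let : Algebra B T' := (ptPow R χ').toRingHom.toAlgebra
  have : IsScalarTower R B T' := IsScalarTower.of_algebraMap_eq fun r =>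
    ((ptPow R χ').commutes r).symm
  let π : P →* (G →* T') := (MonoidHom.compHom (algebraMap B T' : B →* T')).comp ρB
  have hπ : π ∘ χ = χ' := by
    funext i
    refine MonoidHom.ext fun a => ?_
    change ptPow R χ' (MonoidAlgebra.of R (Fin n → G) (Pi.mulSingle i a)) = χ' i a
    rw [ptPow_of, Finset.prod_eq_single i]
    · simp
    · intro j _ hj
      simp [hj]
    · simp
  let eπ : FrameAlong π L := fun p => e'.along (π p)
  obtain ⟨Eπ, hEπ⟩ := exists_isInducedAlong n eπ
  have h1 : ∀ p a, MonoidHom.id (G →* T') (π p) a = AlgHom.id R T' (π p a) := fun p a => rfl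
  have hrel : FrameRel (AlgHom.id R T') π 1 eπ e'.along := fun p l => (one_mul _).symm
  rw [← hπ, hrel.normCoord_eq h1 hEπ he'.along]
  have hinj : Function.Injective (Algebra.TensorProduct.includeRight : T' →ₐ[B] T ⊗[B] T') :=
    Module.FaithfullyFlat.tensorProduct_mk_injective (A := B) (B := T) T'
  refine hinj ?_
  have h2 := normCoord_eq_normCoord
      (g := (Algebra.TensorProduct.includeLeft : T →ₐ[B] T ⊗[B] T').restrictScalars R)
      (g' := (Algebra.TensorProduct.includeRight : T' →ₐ[B] T ⊗[B] T').restrictScalars R)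
      (fun p a => ((Algebra.TensorProduct.includeLeft : T →ₐ[B] T ⊗[B] T').commutes _).trans
        ((Algebra.TensorProduct.includeRight : T' →ₐ[B] T ⊗[B] T').commutes _).symm)
      hE hEπ ξ χ (η 1)
  have h3 : normCoord ξ e E χ (η 1) = 1 := hη
  rw [h3, map_one] at h2
  exact h2.symm.trans (map_one _).symm

end Existence

/-! ### The Taylor expansion in the Picard group -/

section Taylor

open CommRing

variable {R : Type u} [CommRing R] {G : Type u} [CommGroup G]
variable (L : ModuleCat.{u} (MonoidAlgebra R G)) [Module.Invertible (MonoidAlgebra R G) L]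

variable (R G) in
theorem diagHom_comp_mHom (n : ℕ) (I : Finset (Fin n)) :
    (diagHom R G n).comp (mHom R G n I) = pt R (MonoidAlgebra.of R G ^ I.card) := by
  rw [diagHom, ptPow_comp_mHom, Finset.prod_const]

variable (R G) in
theorem zeroHom_comp_diagHom_comp_mHom (n : ℕ) (I : Finset (Fin n)) :
    (zeroHom R G).toRingHom.comp ((diagHom R G n).comp (mHom R G n I)).toRingHom =
      (zeroHom R G).toRingHom := by
  have h : (zeroHom R G).comp ((diagHom R G n).comp (mHom R G n I)) = zeroHom R G := by
    rw [← AlgHom.comp_assoc, zeroHom, pt_comp_diagHom, ptPow_comp_mHom, Finset.prod_const, one_pow]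
  exact congrArg AlgHom.toRingHom h

theorem mk_delta (n : ℕ) :
    Pic.mk (MonoidAlgebra R G) (delta n L) = ∏ I : Finset (Fin n),
      Pic.mapRingHom ((diagHom R G n).comp (mHom R G n I)).toRingHom
        (Pic.mk (MonoidAlgebra R G) L) ^ ((-1 : ℤ) ^ (n - I.card)) := by
  refine (mk_pullback (diagHom R G n).toRingHom (Theta n L)).trans ?_
  have h : Pic.mk (CoordRing R G n) (Theta n L) = ∏ I : Finset (Fin n),
      Pic.mk (CoordRing R G n) (tpow (pullback (mHom R G n I).toRingHom L)
        ((-1) ^ (n - I.card))) := mk_piTensorProduct _ _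
  rw [h, map_prod]
  refine Finset.prod_congr rfl fun I _ => ?_
  rw [mk_tpow, mk_pullback, map_zpow, Pic.mapRingHom_mapRingHom]
  rfl

theorem mk_flat (n : ℕ) :
    Pic.mk (MonoidAlgebra R G) (flat n L) = Pic.mk (MonoidAlgebra R G) (delta n L) *
      Pic.mk (MonoidAlgebra R G) L ^ (-(n.factorial : ℤ)) := by
  rw [← mk_tpow, ← Pic.mk_tensor]
  rfl

/-- The restriction of `δ(L)` to the zero section is trivial: it is a product of powers of `0^* L`
whose exponents add up to `∑_I (-1)^{n - #I} = 0`. -/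
theorem mapRingHom_zeroHom_mk_delta {n : ℕ} (hn : 1 ≤ n) :
    Pic.mapRingHom (zeroHom R G).toRingHom (Pic.mk (MonoidAlgebra R G) (delta n L)) = 1 := by
  have h : ∑ I : Finset (Fin n), (-1 : ℤ) ^ (n - I.card) = 0 := by
    have h0 := Finset.sum_powerset_neg_one_pow_card_of_nonempty
      (x := (Finset.univ : Finset (Fin n))) ⟨⟨0, hn⟩, Finset.mem_univ _⟩
    rw [Finset.powerset_univ] at h0
    rw [← h0]
    refine Fintype.sum_bijective (fun I => Iᶜ) compl_bijective _ _ fun I => ?_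
    rw [Finset.card_compl, Fintype.card_fin]
  rw [mk_delta, map_prod]
  have h1 : ∀ I : Finset (Fin n), Pic.mapRingHom (zeroHom R G).toRingHom
      (Pic.mapRingHom ((diagHom R G n).comp (mHom R G n I)).toRingHom
        (Pic.mk (MonoidAlgebra R G) L) ^ ((-1 : ℤ) ^ (n - I.card))) =
      Pic.mapRingHom (zeroHom R G).toRingHom (Pic.mk (MonoidAlgebra R G) L) ^
        ((-1 : ℤ) ^ (n - I.card)) := fun I => by
    rw [map_zpow, Pic.mapRingHom_mapRingHom, zeroHom_comp_diagHom_comp_mHom]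
  rw [Finset.prod_congr rfl fun I _ => h1 I]
  generalize Pic.mapRingHom (zeroHom R G).toRingHom (Pic.mk (MonoidAlgebra R G) L) = z
  have h2 : ∀ s : Finset (Finset (Fin n)), ∏ I ∈ s, z ^ ((-1 : ℤ) ^ (n - I.card)) =
      z ^ ∑ I ∈ s, (-1 : ℤ) ^ (n - I.card) := fun s => by
    induction s using Finset.cons_induction with
    | empty => rw [Finset.prod_empty, Finset.sum_empty, zpow_zero]
    | cons I s hI ih => rw [Finset.prod_cons, Finset.sum_cons, zpow_add, ih]
  rw [h2, h, zpow_zero]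

theorem mk_delta_one : Pic.mk (MonoidAlgebra R G) (delta 1 L) =
    Pic.mk (MonoidAlgebra R G) L *
      (Pic.mapRingHom (zeroHom R G).toRingHom (Pic.mk (MonoidAlgebra R G) L))⁻¹ := by
  have h0 : ((diagHom R G 1).comp (mHom R G 1 ∅)).toRingHom = (zeroHom R G).toRingHom := by
    rw [diagHom_comp_mHom, Finset.card_empty, pow_zero, zeroHom]
  have h1 : ((diagHom R G 1).comp (mHom R G 1 Finset.univ)).toRingHom = RingHom.id _ := by
    rw [diagHom_comp_mHom, Finset.card_fin, pow_one]
    have : pt R (MonoidAlgebra.of R G) = AlgHom.id R _ :=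
      MonoidAlgebra.algHom_ext (fun g => pt_of _ g) (Subsingleton.elim _ _)
    rw [this]
    rfl
  have hu : (Finset.univ : Finset (Finset (Fin 1))) = {Finset.univ, ∅} := by decide
  rw [mk_delta, hu, Finset.prod_pair (by simp), h0, h1, Pic.mapRingHom_id_apply]
  simp

/-- The Taylor expansion, as an identity in the Picard group: `D i` is the class of
`δ(L^{(i)}, ξ^{(i)})`.  The expansion of `L` is obtained from that of `L^♭` by inserting
`L^♭ = δ(L) ⊗ L^{⊗ -n!}` and `0^* L^♭ = (0^* L)^{⊗ -n!}`. -/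
theorem exists_taylor [Finite G] (n : ℕ) (hn : 1 ≤ n) : ∀ (L : ModuleCat.{u} (MonoidAlgebra R G))
    [Module.Invertible (MonoidAlgebra R G) L] (ξ : Triv (n + 1) L), IsCubic (n + 1) L ξ →
    ∃ X : ℕ → HyperSheaf R G, X 0 = ⟨n + 1, L, ξ⟩ ∧
      (∀ i, i + 1 < n → IsFlatOf (X i) (X (i + 1))) ∧
      (∀ i, i < n → (X i).order = n + 1 - i ∧ (X i).IsCubicSheaf) ∧
      ∃ D : ℕ → Pic (MonoidAlgebra R G),
        (∀ i, i < n → ∃ _ : Module.Invertible (MonoidAlgebra R G) (X i).deltaSheaf,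
          Pic.mk (MonoidAlgebra R G) (X i).deltaSheaf = D i) ∧
        Pic.mk (MonoidAlgebra R G) L ^ (n.superFactorial : ℤ) =
          Pic.mapRingHom (zeroHom R G).toRingHom (Pic.mk (MonoidAlgebra R G) L) ^
              (n.superFactorial : ℤ) *
            ∏ i ∈ Finset.range n, D i ^ ((-1 : ℤ) ^ i * ((n - i - 1).superFactorial : ℤ)) := by
  induction n, hn using Nat.le_induction with
  | base =>
    intro L _ ξ hξ
    refine ⟨fun _ => ⟨2, L, ξ⟩, rfl, fun i hi => by omega, fun i hi => ?_,
      fun _ => Pic.mk (MonoidAlgebra R G) (delta 1 L), fun i _ => ⟨?_, rfl⟩, ?_⟩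
    · obtain rfl : i = 0 := by omega
      exact ⟨rfl, inferInstance, hξ⟩
    · exact inferInstanceAs (Module.Invertible (MonoidAlgebra R G) (delta 1 L))
    · rw [mk_delta_one]
      simp
  | succ n hn ih =>
    intro L _ ξ hξ
    obtain ⟨η, hη⟩ := exists_isFlatStructure ξ
    obtain ⟨X, hX0, hX1, hX2, D, hD, hL⟩ := ih (flat (n + 1) L) η (hη.isCubic (by omega) hξ)
    refine ⟨fun i => Nat.casesOn i ⟨n + 2, L, ξ⟩ X, rfl, fun i hi => ?_, fun i hi => ?_,
      fun i => Nat.casesOn i (Pic.mk (MonoidAlgebra R G) (delta (n + 1) L)) D, fun i hi => ?_, ?_⟩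
    · cases i with
      | zero =>
        change IsFlatOf _ (X 0)
        rw [hX0]
        exact .mk (n + 1) L ξ η hη
      | succ i => exact hX1 i (by omega)
    · cases i with
      | zero => exact ⟨rfl, inferInstance, hξ⟩
      | succ i =>
        obtain ⟨h, h'⟩ := hX2 i (by omega)
        exact ⟨h.trans (by omega), h'⟩
    · cases i with
      | zero => exact ⟨inferInstanceAs (Module.Invertible (MonoidAlgebra R G) (delta (n + 1) L)), rfl⟩
      | succ i => exact hD i (by omega)
    · rw [mk_flat, map_mul, mapRingHom_zeroHom_mk_delta L (by omega), one_mul, map_zpow] at hL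
      rw [Finset.prod_range_succ', Nat.superFactorial_succ]
      have h : ∏ i ∈ Finset.range n, D i ^ ((-1 : ℤ) ^ (i + 1) *
          ((n + 1 - (i + 1) - 1).superFactorial : ℤ)) =
          (∏ i ∈ Finset.range n, D i ^ ((-1 : ℤ) ^ i * ((n - i - 1).superFactorial : ℤ)))⁻¹ := by
        rw [← Finset.prod_inv_distrib]
        refine Finset.prod_congr rfl fun i _ => ?_
        rw [← zpow_neg, Nat.add_sub_add_right, pow_succ]
        congr 1
        ring
      change _ = _ * ((∏ i ∈ Finset.range n, D i ^ ((-1 : ℤ) ^ (i + 1) *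
          ((n + 1 - (i + 1) - 1).superFactorial : ℤ))) *
        Pic.mk (MonoidAlgebra R G) (delta (n + 1) L) ^ ((-1 : ℤ) ^ 0 * (n.superFactorial : ℤ)))
      rw [h, eq_inv_mul_of_mul_eq hL.symm, pow_zero, one_mul, Nat.cast_mul]
      generalize Pic.mk (MonoidAlgebra R G) L = l
      generalize Pic.mk (MonoidAlgebra R G) (delta (n + 1) L) = d
      generalize Pic.mapRingHom (zeroHom R G).toRingHom l = z
      rw [mul_zpow, ← zpow_mul, ← zpow_mul, neg_mul, zpow_neg, zpow_neg, inv_inv, mul_inv, mul_inv,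
        inv_inv, mul_assoc _ _ (d ^ _), mul_inv_cancel_left, mul_right_comm, inv_mul_cancel, one_mul]

end Taylor

end Hypercubic

end

theorem mainTheorem11 (R : Type u) [CommRing R] (G : Type u) [CommGroup G] [Finite G] :
    (∀ n : ℕ, 2 ≤ n → ∀ L : ModuleCat.{u} (MonoidAlgebra R G),
      Module.Invertible (MonoidAlgebra R G) L →
      ∀ ξ : Hypercubic.Triv (n + 1) L, Hypercubic.IsCubic (n + 1) L ξ →
        Module.Invertible (MonoidAlgebra R G) (Hypercubic.flat n L) ∧
        (∃! η : Hypercubic.Triv n (Hypercubic.flat n L), Hypercubic.IsFlatStructure ξ η) ∧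
        (∀ η : Hypercubic.Triv n (Hypercubic.flat n L), Hypercubic.IsFlatStructure ξ η →
          Hypercubic.IsCubic n (Hypercubic.flat n L) η)) ∧
    (∀ n : ℕ, 1 ≤ n → ∀ L : ModuleCat.{u} (MonoidAlgebra R G),
      Module.Invertible (MonoidAlgebra R G) L →
      ∀ ξ : Hypercubic.Triv (n + 1) L, Hypercubic.IsCubic (n + 1) L ξ →
        ∃ X : ℕ → Hypercubic.HyperSheaf R G,
          X 0 = ⟨n + 1, L, ξ⟩ ∧
          (∀ i, i + 1 < n → Hypercubic.IsFlatOf (X i) (X (i + 1))) ∧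
          (∀ i, i < n → (X i).order = n + 1 - i ∧ (X i).IsCubicSheaf) ∧
          Nonempty (Hypercubic.tpow L (n.superFactorial : ℤ) ≃ₗ[MonoidAlgebra R G]
            TensorProduct (MonoidAlgebra R G)
              (Hypercubic.tpow (Hypercubic.pullback (Hypercubic.zeroHom R G).toRingHom L)
                (n.superFactorial : ℤ))
              (PiTensorProduct (MonoidAlgebra R G) (fun i : Fin n =>
                Hypercubic.tpow (X i).deltaSheaf
                  ((-1) ^ (i : ℕ) * ((n - i - 1).superFactorial : ℤ)))))) := by
  refine ⟨fun n hn L _ ξ hξ => ⟨inferInstance, ?_, fun η hη => hη.isCubic hn hξ⟩,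
    fun n hn L _ ξ hξ => ?_⟩
  · obtain ⟨η, hη⟩ := Hypercubic.exists_isFlatStructure ξ
    exact ⟨η, hη, fun η' hη' => hη.unique hη'⟩
  · obtain ⟨X, h0, h1, h2, D, hD, hL⟩ := Hypercubic.exists_taylor n hn L ξ hξ
    refine ⟨X, h0, h1, h2, ?_⟩
    have hinv : ∀ i : Fin n, Module.Invertible (MonoidAlgebra R G) (X i).deltaSheaf := fun i =>
      (hD i i.isLt).1
    rw [← CommRing.Pic.mk_eq_mk_iff, CommRing.Pic.mk_tensor, Hypercubic.mk_piTensorProduct,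
      Hypercubic.mk_tpow, Hypercubic.mk_tpow, Hypercubic.mk_pullback, hL, Finset.prod_range]
    congr 1
    refine Finset.prod_congr rfl fun i _ => ?_
    rw [Hypercubic.mk_tpow, (hD i i.isLt).2]
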